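/- \textbf{Setting.} Let $\omega=e^{2\pi i/3}$, $|{+}\rangle=|0\rangle+|1\rangle+|2\rangle$, $|\omega\rangle=|0\rangle+\omega|1\rangle+\omega^2|2\rangle$, $|\bar\omega\rangle=|0\rangle+\omega^2|1\rangle+\omega|2\rangle$. Diagrams of the qutrit ZX-calculus are read from top to bottom and are built by sequential composition (written $D_1;D_2$, with $D_1$ on top) and parallel composition from the empty diagram, the wire, the swap of two wires, the nodes $H,H^\dagger:1\to1$, and green and red spiders $n\to m$ with a pair $(\alpha,\beta)$ of phase angles modulo $2\pi$. Their standard interpretation, up to a non-zero scalar, sends the green spider to $|0\rangle^{\otimes m}\langle0|^{\otimes n}+e^{i\alpha}|1\rangle^{\otimes m}\langle1|^{\otimes n}+e^{i\beta}|2\rangle^{\otimes m}\langle2|^{\otimes n}$, the red spider to $|{+}\rangle^{\otimes m}\langle{+}|^{\otimes n}+e^{i\alpha}|\omega\rangle^{\otimes m}\langle\omega|^{\otimes n}+e^{i\beta}|\bar\omega\rangle^{\otimes m}\langle\bar\omega|^{\otimes n}$, $H$ to $|{+}\rangle\langle0|+|\omega\rangle\langle1|+|\bar\omega\rangle\langle2|$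 and $H^\dagger$ to its adjoint. Write $g_{(a_1,a_2)}$ and $r_{(a_1,a_2)}$ for the green and red $1\to1$ nodes with phase angles $\frac{2\pi}{3}a_1,\frac{2\pi}{3}a_2$, where $a_1,a_2\in\mathbb Z_3$, and omit zero phases. A diagram \emph{can be rewritten} into another one if the two are identified by the congruence generated by the laws of a strict symmetric monoidal category and the following rules. (S1) Two green spiders connected by at least one wire fuse and their phase pairs add up. (S2) The green $1\to1$ spider with zero phases is a wire. (S3) Swapping two adjacent legs of a green spider does not change it. (B1) The red state $0\to1$ followed by the green spider $1\to2$ is a pair of red states. (B2) Two green spiders $1\to2$ side by side, followed by a swap of the two middle wires and two red spiders $2\to1$ side by side, equal the red spider $2\to1$ followed by the green spider $1\to2$. (K1) For $m\in\{(1,2),(2,1)\}$, $r_m$ followed by the green spider $1\to n$ is the green spider $1\to n$ followed by $r_m$ on every output. (K2) $r_{(1,2)};g(\alpha,\beta)=g(-\beta,\alpha-\beta);r_{(1,2)}$ and $r_{(2,1)};g(\alpha,\beta)=g(\beta-\alpha,-\alpha);r_{(2,1)}$, where $g(\alpha,\beta)$ is the green $1\to1$ node with arbitrary angles. (H1) $H;H^\dagger$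 and $H^\dagger;H$ are wires. (EU) $H=g_{(2,2)};r_{(2,2)};g_{(2,2)}$. (H2) A green spider with phases $(\alpha,\beta)$, with $H^\dagger$ on all inputs and $H$ on all outputs, is the red spider with phases $(\alpha,\beta)$. (H2$'$) With $H$ on all inputs and $H^\dagger$ on all outputs it is the red spider with phases $(\beta,\alpha)$. (P1) $H;H$ is the wire bent by a green cap $0\to2$ on its right and a red cup $2\to0$ on its left, and $H^\dagger;H^\dagger$ is the same with the two colours exchanged. The Pauli group $\mathcal P_1$ consists of the matrices $\omega^\delta X^vZ^w$ with $\delta,v,w\in\mathbb Z_3$, where $X|j\rangle=|j+1\rangle$ and $Z|j\rangle=\omega^j|j\rangle$. The local Clifford group is $\mathcal C_1=\{Q\text{ unitary}: Q\mathcal P_1Q^\dagger=\mathcal P_1\}$. A \emph{diagram of a single-qutrit Clifford operator} is a sequential composition of wires, nodes $g_a$, $r_a$ with $a\in\mathbb Z_3^2$, $H$ and $H^\dagger$. Let $\mathcal P=\{(1,1),(2,2)\}$, $\mathcal N=\{(0,1),(1,0),(0,2),(2,0)\}$, $\mathcal M=\{(0,0),(1,2),(2,1)\}$, $\mathcal Q=\mathcal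 P\cup\mathcal N$ and $\mathcal A=\mathcal Q\cup\mathcal M$. \textbf{Theorem.} Every diagram of a single-qutrit Clifford operator can be rewritten into exactly one diagram of the following three forms (exactly one form, with exactly one choice of parameters), listed from top to bottom: (1) $g_a;r_{a'}$ with $a,a'\in\mathcal A$; (2) $g_a;r_p;g_q$ with $a\in\mathcal A$, $p\in\mathcal P$, $q\in\mathcal Q$; (3) $g_a;H;H;r_m$ with $a\in\mathcal A$, $m\in\mathcal M$. The same holds for the forms obtained by exchanging the two colours throughout, by reversing the order of the nodes throughout, or by both. These are $81+108+27=216$ normal forms. Every diagram of a single-qutrit Clifford operator represents an element of $\mathcal C_1$ up to a non-zero scalar, and every element of $\mathcal C_1$ is represented, up to a non-zero scalar, by exactly one normal form. Consequently the calculus is sound and complete for $\mathcal C_1$: two diagrams of single-qutrit Clifford operators can be rewritten into each other if and only if their standard interpretations agree up to a non-zero scalar. -/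

import Mathlib

open scoped Matrix

noncomputable section

namespace QutritZX

/-! ### Diagrams -/

/-- The two colours of spiders: green spiders are the `Z`-spiders `R_Z`, red ones the
`X`-spiders `R_X`. -/
inductive Colour
  | green
  | red

/-- The other colour. -/
def Colour.flip : Colour → Colour
  | .green => .red
  | .red => .green

/-- Diagrams of the qutrit ZX-calculus with `n` inputs (top) and `m` outputs (bottom).
Phase angles are real numbers modulo `2π`. In `comp D₁ D₂` the diagram `D₁` stands above `D₂`, so it
is applied first. -/
inductive Diagram : ℕ → ℕ → Type
  | spider (c : Colour) (n m : ℕ) (α β : Real.Angle) : Diagram n m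
  | had : Diagram 1 1
  | hadDag : Diagram 1 1
  | swap : Diagram 2 2
  | wire : Diagram 1 1
  | empty : Diagram 0 0
  | comp {a b d : ℕ} (D₁ : Diagram a b) (D₂ : Diagram b d) : Diagram a d
  | tensor {a b c d : ℕ} (D₁ : Diagram a b) (D₂ : Diagram c d) : Diagram (a + c) (b + d)

namespace Diagram

scoped infixl:70 " ⨾ " => Diagram.comp
scoped infixl:75 " ⊠ " => Diagram.tensor

/-- Transport of a diagram along equalities between its numbers of inputs and outputs. -/
def cast {n n' m m' : ℕ} (hn : n = n') (hm : m = m') (D : Diagram n m) : Diagram n' m' :=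
  hn ▸ hm ▸ D

/-- `n` copies of a one-wire diagram side by side. -/
def tpow (D : Diagram 1 1) : (n : ℕ) → Diagram n n
  | 0 => empty
  | n + 1 => tpow D n ⊠ D

/-- `n` parallel wires, the identity on the object `n`. -/
def ident (n : ℕ) : Diagram n n := tpow wire n

/-- The symmetry `n ⊗ 1 → 1 ⊗ n`: the last wire crosses the `n` wires on its left. -/
def swapOne : (n : ℕ) → Diagram (n + 1) (1 + n)
  | 0 => wire
  | n + 1 => @comp (n + 2) (n + 2) (1 + (n + 1)) (ident n ⊠ swap)
      (@tensor (n + 1) (1 + n) 1 1 (swapOne n) wire)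

end Diagram

open Diagram

/-! ### The standard interpretation -/

/-- `ω = exp (2πi/3)`. -/
def ω : ℂ := Complex.exp (2 * Real.pi / 3 * Complex.I)

/-- `ω ^ k` for `k` modulo `3`. -/
def ωpow (k : ZMod 3) : ℂ := ω ^ k.val

/-- The coefficients `1, e^{iα}, e^{iβ}` of a spider. -/
def phaseCoeff (α β : Real.Angle) (j : ZMod 3) : ℂ :=
  if j = 0 then 1 else if j = 1 then (α.toCircle : ℂ) else (β.toCircle : ℂ)

/-- The `j`-th vector of the basis that belongs to a colour, in coordinates: the computational basis
`|0⟩, |1⟩, |2⟩` for green, and the vectors `|+⟩ = |0⟩+|1⟩+|2⟩`, `|ω⟩ = |0⟩+ω|1⟩+ω²|2⟩`,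
`|ω̄⟩ = |0⟩+ω²|1⟩+ω|2⟩` for red. -/
def ket : Colour → ZMod 3 → ZMod 3 → ℂ
  | .green, j, k => if k = j then 1 else 0
  | .red, j, k => ωpow (j * k)

/-- Matrices of linear maps from `n` qutrits to `m` qutrits, in the computational basis:
rows are indexed by outputs, columns by inputs. -/
abbrev QMatrix (n m : ℕ) : Type := Matrix (Fin m → ZMod 3) (Fin n → ZMod 3) ℂ

/-- The standard interpretation of diagrams; only its class up to a non-zero scalar matters. -/
def interp : {n m : ℕ} → Diagram n m → QMatrix n m
  | _, _, .spider c _ _ α β => fun y x =>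
      ∑ j : ZMod 3, phaseCoeff α β j * (∏ i, ket c j (y i)) * (∏ i, star (ket c j (x i)))
  | _, _, .had => fun y x => ∑ j : ZMod 3, ket .red j (y 0) * star (ket .green j (x 0))
  | _, _, .hadDag => fun y x => ∑ j : ZMod 3, ket .green j (y 0) * star (ket .red j (x 0))
  | _, _, .swap => fun y x => if y 0 = x 1 ∧ y 1 = x 0 then 1 else 0
  | _, _, .wire => 1
  | _, _, .empty => 1
  | _, _, .comp D₁ D₂ => interp D₂ * interp D₁
  | _, _, @Diagram.tensor a b c d D₁ D₂ => fun y x =>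
      interp D₁ (fun i => y (Fin.castAdd d i)) (fun i => x (Fin.castAdd c i)) *
        interp D₂ (fun i => y (Fin.natAdd b i)) (fun i => x (Fin.natAdd a i))

/-- Equality of matrices up to a non-zero scalar. -/
def Proportional {n m : ℕ} (A B : QMatrix n m) : Prop := ∃ k : ℂ, k ≠ 0 ∧ A = k • B

/-! ### The calculus -/

/-- The phase angles `0, 2π/3, 4π/3`, denoted `0, 1, 2`. -/
def angle (k : ZMod 3) : Real.Angle := ((2 * Real.pi / 3 * (k.val : ℝ) : ℝ) : Real.Angle)

/-- The one-wire node of colour `c` with phase angles `a = (a₁, a₂)` in multiples of `2π/3`. -/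
def phase (c : Colour) (a : ZMod 3 × ZMod 3) : Diagram 1 1 :=
  .spider c 1 1 (angle a.1) (angle a.2)

/-- `Derivable D D'`: the diagram `D` can be rewritten into `D'` in the qutrit ZX-calculus. This is
the congruence generated by the laws of a strict symmetric monoidal category and the
rewriting rules of the calculus. -/
inductive Derivable : {n m : ℕ} → Diagram n m → Diagram n m → Prop
  -- equivalence relation and congruence
  | refl {n m : ℕ} (D : Diagram n m) : Derivable D D
  | symm {n m : ℕ} {D D' : Diagram n m} : Derivable D D' → Derivable D' D
  | trans {n m : ℕ} {D D' D'' : Diagram n m} :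
      Derivable D D' → Derivable D' D'' → Derivable D D''
  | comp_congr {a b c : ℕ} {D D' : Diagram a b} {E E' : Diagram b c} :
      Derivable D D' → Derivable E E' → Derivable (D ⨾ E) (D' ⨾ E')
  | tensor_congr {a b c d : ℕ} {D D' : Diagram a b} {E E' : Diagram c d} :
      Derivable D D' → Derivable E E' → Derivable (D ⊠ E) (D' ⊠ E')
  -- strict monoidal category
  | comp_assoc {a b c d : ℕ} (D : Diagram a b) (E : Diagram b c) (F : Diagram c d) :
      Derivable ((D ⨾ E) ⨾ F) (D ⨾ (E ⨾ F))
  | id_comp {n m : ℕ} (D : Diagram n m) : Derivable (ident n ⨾ D) D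
  | comp_id {n m : ℕ} (D : Diagram n m) : Derivable (D ⨾ ident m) D
  | tensor_assoc {a b c d e f : ℕ} (D : Diagram a b) (E : Diagram c d) (F : Diagram e f) :
      Derivable (((D ⊠ E) ⊠ F).cast (Nat.add_assoc a c e) (Nat.add_assoc b d f)) (D ⊠ (E ⊠ F))
  | empty_tensor {n m : ℕ} (D : Diagram n m) :
      Derivable ((empty ⊠ D).cast (Nat.zero_add n) (Nat.zero_add m)) D
  | tensor_empty {n m : ℕ} (D : Diagram n m) :
      Derivable ((D ⊠ empty).cast (Nat.add_zero n) (Nat.add_zero m)) D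
  | interchange {a b c a' b' c' : ℕ} (D : Diagram a b) (E : Diagram b c)
      (D' : Diagram a' b') (E' : Diagram b' c') :
      Derivable ((D ⊠ D') ⨾ (E ⊠ E')) ((D ⨾ E) ⊠ (D' ⨾ E'))
  -- symmetry; the crossings of several wires and their naturality follow from these two laws
  | swap_swap : Derivable (swap ⨾ swap) (ident 2)
  | swap_natural {n m : ℕ} (D : Diagram n m) :
      Derivable ((D ⊠ wire) ⨾ swapOne m) (swapOne n ⨾ (wire ⊠ D))
  -- (S1): two green spiders connected by at least one wire fuse and their phases add up
  | S1 (a b k c d : ℕ) (α β η θ : Real.Angle) :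
      Derivable
        (((spider .green a (b + (k + 1)) α β ⊠ ident c).cast rfl (Nat.add_assoc b (k + 1) c)) ⨾
          (ident b ⊠ spider .green ((k + 1) + c) d η θ))
        (spider .green (a + c) (b + d) (α + η) (β + θ))
  -- (S2): a green node with one input, one output and zero phases is a wire
  | S2 : Derivable (spider .green 1 1 0 0) wire
  -- (S3): the legs of a green spider, in particular of a cup or a cap, can be swapped
  | S3_out (n a b : ℕ) (α β : Real.Angle) :
      Derivable (spider .green n (a + 2 + b) α β ⨾ ((ident a ⊠ swap) ⊠ ident b))
        (spider .green n (a + 2 + b) α β)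
  | S3_in (m a b : ℕ) (α β : Real.Angle) :
      Derivable (((ident a ⊠ swap) ⊠ ident b) ⨾ spider .green (a + 2 + b) m α β)
        (spider .green (a + 2 + b) m α β)
  -- (B1): green copies the red state
  | B1 : Derivable (spider .red 0 1 0 0 ⨾ spider .green 1 2 0 0)
      (spider .red 0 1 0 0 ⊠ spider .red 0 1 0 0)
  -- (B2): bialgebra rule
  | B2 : Derivable
      (@comp 2 4 2
        (@comp 2 4 4 (spider .green 1 2 0 0 ⊠ spider .green 1 2 0 0)
          (@tensor 3 3 1 1 (wire ⊠ swap) wire))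
        (spider .red 2 1 0 0 ⊠ spider .red 2 1 0 0))
      (spider .red 2 1 0 0 ⨾ spider .green 1 2 0 0)
  -- (K1): red nodes with phases (1,2) or (2,1) are copied by green spiders
  | K1_12 (n : ℕ) : Derivable (phase .red (1, 2) ⨾ spider .green 1 n 0 0)
      (spider .green 1 n 0 0 ⨾ tpow (phase .red (1, 2)) n)
  | K1_21 (n : ℕ) : Derivable (phase .red (2, 1) ⨾ spider .green 1 n 0 0)
      (spider .green 1 n 0 0 ⨾ tpow (phase .red (2, 1)) n)
  -- (K2): commutation of red nodes with phases (1,2) or (2,1) with green phases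
  | K2_12 (α β : Real.Angle) : Derivable (phase .red (1, 2) ⨾ spider .green 1 1 α β)
      (spider .green 1 1 (-β) (α - β) ⨾ phase .red (1, 2))
  | K2_21 (α β : Real.Angle) : Derivable (phase .red (2, 1) ⨾ spider .green 1 1 α β)
      (spider .green 1 1 (β - α) (-α) ⨾ phase .red (2, 1))
  -- (H1): the two Hadamard nodes are inverse to each other
  | H1_left : Derivable (had ⨾ hadDag) wire
  | H1_right : Derivable (hadDag ⨾ had) wire
  -- (EU): Euler decomposition of the Hadamard node
  | EU : Derivable had (phase .green (2, 2) ⨾ phase .red (2, 2) ⨾ phase .green (2, 2))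
  -- (H2), (H2'): the two colour change rules
  | H2 (n m : ℕ) (α β : Real.Angle) :
      Derivable (tpow hadDag n ⨾ spider .green n m α β ⨾ tpow had m) (spider .red n m α β)
  | H2' (n m : ℕ) (α β : Real.Angle) :
      Derivable (tpow had n ⨾ spider .green n m α β ⨾ tpow hadDag m) (spider .red n m β α)
  -- (P1): the dualiser, built from a cup and a cap of different colours
  | P1_had : Derivable (had ⨾ had)
      ((wire ⊠ spider .green 0 2 0 0) ⨾ (spider .red 2 0 0 0 ⊠ wire) : Diagram 1 1)
  | P1_hadDag : Derivable (hadDag ⨾ hadDag)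
      ((wire ⊠ spider .red 0 2 0 0) ⨾ (spider .green 2 0 0 0 ⊠ wire) : Diagram 1 1)

/-! ### The Clifford group -/

/-- The operator `XZ(v, w) = X^{v₁}Z^{w₁} ⊗ ⋯ ⊗ X^{vₙ}Z^{wₙ}`, which sends the basis vector `|x⟩` to
`ω^{w₁x₁+⋯+wₙxₙ} |x + v⟩`. -/
def XZ {n : ℕ} (v w : Fin n → ZMod 3) : QMatrix n n :=
  fun y x => if y = x + v then ωpow (∑ i, w i * x i) else 0

/-- The generalized Pauli group on `n` qutrits. -/
def pauliGroup (n : ℕ) : Set (QMatrix n n) :=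
  {P | ∃ (δ : ZMod 3) (v w : Fin n → ZMod 3), P = ωpow δ • XZ v w}

/-- The generalized Clifford group on `n` qutrits: the unitaries that normalize the Pauli group. -/
def cliffordGroup (n : ℕ) : Set (QMatrix n n) :=
  {Q | Q ∈ Matrix.unitaryGroup (Fin n → ZMod 3) ℂ ∧
    (fun P => Q * P * Qᴴ) '' pauliGroup n = pauliGroup n}

/-- Diagrams of single-qutrit Clifford operators: one-wire diagrams composed of green and red nodes
with one input and one output and with phase angles in `{0, 2π/3, 4π/3}`, and of the nodes `H` and
`H†`. -/
inductive IsCliffordDiagram : Diagram 1 1 → Prop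
  | wire : IsCliffordDiagram wire
  | phase (c : Colour) (a : ZMod 3 × ZMod 3) : IsCliffordDiagram (phase c a)
  | had : IsCliffordDiagram had
  | hadDag : IsCliffordDiagram hadDag
  | comp {D E : Diagram 1 1} :
      IsCliffordDiagram D → IsCliffordDiagram E → IsCliffordDiagram (D ⨾ E)

/-! ### Normal forms -/

/-- The set `𝓟 = {(1,1), (2,2)}` of phase pairs. -/
def setP : Finset (ZMod 3 × ZMod 3) := {(1, 1), (2, 2)}

/-- The set `𝓝 = {(1,0), (0,1), (2,0), (0,2)}` of phase pairs. -/
def setN : Finset (ZMod 3 × ZMod 3) := {(1, 0), (0, 1), (2, 0), (0, 2)}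

/-- The set `𝓜 = {(0,0), (1,2), (2,1)}` of phase pairs. -/
def setM : Finset (ZMod 3 × ZMod 3) := {(0, 0), (1, 2), (2, 1)}

/-- `𝓠 = 𝓟 ∪ 𝓝`. -/
def setQ : Finset (ZMod 3 × ZMod 3) := setP ∪ setN

/-- `𝓐 = 𝓠 ∪ 𝓜`. -/
def setA : Finset (ZMod 3 × ZMod 3) := setQ ∪ setM

/-- The parameters of the three families of normal forms. -/
inductive NormalForm
  | form1 (a b : setA)
  | form2 (a : setA) (p : setP) (q : setQ)
  | form3 (a : setA) (m : setM)

/-- The normal form diagrams, listed in order from top to bottom. The argument `c` is the colour of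
the outer nodes. -/
def NormalForm.diagram (c : Colour) : NormalForm → Diagram 1 1
  | .form1 a b => phase c a ⨾ phase c.flip b
  | .form2 a p q => phase c a ⨾ phase c.flip p ⨾ phase c q
  | .form3 a m => phase c a ⨾ had ⨾ had ⨾ phase c.flip m

/-- The same diagrams with their nodes in the opposite order. -/
def NormalForm.mirror (c : Colour) : NormalForm → Diagram 1 1
  | .form1 a b => phase c.flip b ⨾ phase c a
  | .form2 a p q => phase c q ⨾ phase c.flip p ⨾ phase c a
  | .form3 a m => phase c.flip m ⨾ had ⨾ had ⨾ phase c a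

end QutritZX

end

open scoped Matrix

namespace QutritZX

open Diagram

/-! ### The cube root of unity -/

/-! No diagram is ever rewritten explicitly into a normal form; completeness comes from soundness
and two counts that both give 216.

Soundness (`Derivable.sound`) is an induction over the rules. Spiders are sums over `j` of product
vectors, and phases in multiples of `2π/3` are powers of `ω` with quadratic exponent, so most rules
reduce to reindexing, orthogonality of characters, or completing a square.

Upper bound for the calculus: one-wire diagrams modulo rewriting form a monoid. The green nodes `s`
with phases (2,2) and `z` with phases (1,2) and the Hadamard node `h` are units of it, and
`OneWire.cliffordRelations` derives relations among them from S1, S2, K2, H1, EU, H2 and H2'. These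
relations bring every product of `s`, `z`, `h` to one of 27·2·(1+3) = 216 words
(`CliffordRelations.closure_subset_range`): a Pauli part in `z` and `x = h⁻¹zh`, followed by a
Bruhat decomposition of SL(2,3), where `h²` plays the role of -1.

Lower bound by semantics: a Clifford diagram permutes the Pauli matrices by conjugation, and this
action sees only the matrix up to a scalar. It separates the 216 normal forms (`diagram_injective`,
`mirror_injective`). By soundness, distinct normal forms then have distinct words, so by pigeonhole
all words are taken and every Clifford diagram rewrites to a normal form; uniqueness is soundness
again.

For the Clifford group, a matrix is determined up to a scalar by the images of `X` and `Z`
(`Conjugates.proportional`). These images must satisfy the relation `ZX = ωXZ`, which leaves 216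
pairs, and the same pigeonhole argument applies. -/

theorem ω_pow_three : ω ^ 3 = 1 := by
  rw [ω, ← Complex.exp_nat_mul]
  convert Complex.exp_two_pi_mul_I using 2
  push_cast
  ring

theorem ω_ne_one : ω ≠ 1 := by
  intro h
  rw [ω, Complex.exp_eq_one_iff] at h
  obtain ⟨n, hn⟩ := h
  have hp : (2 * Real.pi * Complex.I : ℂ) ≠ 0 := by simp [Real.pi_ne_zero]
  have h1 : (1 : ℂ) = 3 * n := by
    apply mul_right_cancel₀ hp
    linear_combination 3 * hn
  have h2 : (1 : ℤ) = 3 * n := by exact_mod_cast h1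
  omega

theorem ω_quadratic : 1 + ω + ω ^ 2 = 0 := by
  have h : (ω - 1) * (1 + ω + ω ^ 2) = 0 := by linear_combination ω_pow_three
  exact (mul_eq_zero.1 h).resolve_left (sub_ne_zero.2 ω_ne_one)

theorem ω_ne_zero : ω ≠ 0 := Complex.exp_ne_zero _

theorem ωpow_natCast (n : ℕ) : ωpow (n : ZMod 3) = ω ^ n := by
  rw [ωpow, ZMod.val_natCast]
  conv_rhs => rw [← Nat.mod_add_div n 3, pow_add, pow_mul, ω_pow_three, one_pow, mul_one]

@[simp] theorem ωpow_zero : ωpow 0 = 1 := by simp [ωpow]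

theorem ωpow_one : ωpow 1 = ω := by simpa using ωpow_natCast 1

theorem ωpow_two : ωpow 2 = ω ^ 2 := ωpow_natCast 2

theorem ωpow_add (a b : ZMod 3) : ωpow (a + b) = ωpow a * ωpow b := by
  rw [← ZMod.natCast_zmod_val a, ← ZMod.natCast_zmod_val b, ← Nat.cast_add, ωpow_natCast,
    ωpow_natCast, ωpow_natCast, pow_add]

theorem ωpow_ne_zero (a : ZMod 3) : ωpow a ≠ 0 := pow_ne_zero _ ω_ne_zero

theorem ωpow_neg_mul (a : ZMod 3) : ωpow (-a) * ωpow a = 1 := by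
  rw [← ωpow_add]; simp

theorem star_ω : star ω = ω ^ 2 := by
  have h : star ω = ω⁻¹ := by
    rw [ω, ← Complex.exp_neg, Complex.star_def, ← Complex.exp_conj]
    congr 1
    simp [Complex.conj_ofNat]
  rw [h]
  field_simp [ω_ne_zero]
  linear_combination -ω_pow_three

theorem star_ωpow (a : ZMod 3) : star (ωpow a) = ωpow (-a) := by
  have h : star (ωpow a) * ωpow a = 1 := by
    rw [ωpow, star_pow, star_ω, ← mul_pow]
    have : ω ^ 2 * ω = 1 := by linear_combination ω_pow_three
    rw [this, one_pow]
  exact mul_right_cancel₀ (ωpow_ne_zero a) (h.trans (ωpow_neg_mul a).symm)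

theorem zmod_three_cases (a : ZMod 3) : a = 0 ∨ a = 1 ∨ a = 2 := by
  revert a; decide

theorem ωpow_injective : Function.Injective ωpow := by
  have h0 : ∀ a : ZMod 3, ωpow a = 1 → a = 0 := by
    intro a
    have h12 : ω ^ 2 ≠ 1 := fun h => ω_ne_one (by linear_combination ω_pow_three - ω * h)
    rcases zmod_three_cases a with rfl | rfl | rfl
    · simp
    · intro h; exact absurd (ωpow_one.symm.trans h) ω_ne_one
    · intro h; exact absurd (ωpow_two.symm.trans h) h12
  intro a b h
  have h1 : ωpow (a - b) = 1 := by
    rw [sub_eq_add_neg, ωpow_add, h, mul_comm, ωpow_neg_mul]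
  exact sub_eq_zero.1 (h0 _ h1)

theorem sum_zmod_three {M : Type*} [AddCommMonoid M] (f : ZMod 3 → M) :
    ∑ j, f j = f 0 + f 1 + f 2 := Fin.sum_univ_three f

/-- Orthogonality of the characters of `ZMod 3`; the source of most of the scalars 3 below. -/
theorem sum_ωpow_mul (d : ZMod 3) : ∑ j : ZMod 3, ωpow (j * d) = if d = 0 then 3 else 0 := by
  rw [sum_zmod_three]
  rcases zmod_three_cases d with rfl | rfl | rfl
  · simp; norm_num
  · have h : (1 : ZMod 3) ≠ 0 := by decide
    simp [ωpow_one, ωpow_two, h, ω_quadratic]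
  · have h : (2 : ZMod 3) ≠ 0 := by decide
    have h4 : (2 : ZMod 3) * 2 = 1 := by decide
    simp only [zero_mul, one_mul, h4, ωpow_zero, ωpow_one, ωpow_two, h, if_false]
    linear_combination ω_quadratic

theorem toCircle_angle (k : ZMod 3) : ((angle k).toCircle : ℂ) = ωpow k := by
  rw [angle, Real.Angle.toCircle_coe, Circle.coe_exp, ωpow, ω, ← Complex.exp_nat_mul]
  congr 1
  push_cast
  ring

@[simp] theorem angle_zero : angle 0 = 0 := by simp [angle]

theorem phaseCoeff_zero_zero (j : ZMod 3) : phaseCoeff 0 0 j = 1 := by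
  simp [phaseCoeff]

/-- Quadratic interpolation modulo 3 through the values 0, `a`, `b`. A single exponent formula
replaces the case distinction, so products of phases become sums of polynomials. -/
theorem phaseCoeff_angle (a b j : ZMod 3) :
    phaseCoeff (angle a) (angle b) j = ωpow (-(a + b) * j ^ 2 + (b - a) * j) := by
  have h : ∀ a b j : ZMod 3, -(a + b) * j ^ 2 + (b - a) * j =
    if j = 0 then 0 else if j = 1 then a else b := by decide
  rw [h, phaseCoeff, toCircle_angle, toCircle_angle]
  split_ifs <;> simp

theorem phaseCoeff_add (α β η θ : Real.Angle) (j : ZMod 3) :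
    phaseCoeff (α + η) (β + θ) j = phaseCoeff α β j * phaseCoeff η θ j := by
  unfold phaseCoeff
  split_ifs <;> simp [Real.Angle.toCircle_add]

/-- Negation exchanges 1 and 2 in `ZMod 3`; this is why the phases are swapped in H2'. -/
theorem phaseCoeff_swap (α β : Real.Angle) (j : ZMod 3) :
    phaseCoeff β α (-j) = phaseCoeff α β j := by
  have h1 : (-1 : ZMod 3) = 2 := by decide
  have h2 : (-2 : ZMod 3) = 1 := by decide
  have h3 : (2 : ZMod 3) ≠ 0 := by decide
  have h4 : (2 : ZMod 3) ≠ 1 := by decide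
  rcases zmod_three_cases j with rfl | rfl | rfl <;> simp [phaseCoeff, h1, h2, h3, h4]

/-! ### Proportional matrices -/

namespace Proportional

theorem of_eq {n m : ℕ} {A B : QMatrix n m} (h : A = B) : Proportional A B :=
  ⟨1, one_ne_zero, by simpa using h⟩

theorem symm {n m : ℕ} {A B : QMatrix n m} (h : Proportional A B) : Proportional B A := by
  obtain ⟨k, hk, rfl⟩ := h
  exact ⟨k⁻¹, inv_ne_zero hk, by rw [smul_smul, inv_mul_cancel₀ hk, one_smul]⟩

theorem trans {n m : ℕ} {A B C : QMatrix n m} (h : Proportional A B) (h' : Proportional B C) :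
    Proportional A C := by
  obtain ⟨k, hk, rfl⟩ := h
  obtain ⟨l, hl, rfl⟩ := h'
  exact ⟨k * l, mul_ne_zero hk hl, by rw [smul_smul]⟩

theorem mul {a b c : ℕ} {A A' : QMatrix b c} {B B' : QMatrix a b} (h : Proportional A A')
    (h' : Proportional B B') : Proportional (A * B) (A' * B') := by
  obtain ⟨k, hk, rfl⟩ := h
  obtain ⟨l, hl, rfl⟩ := h'
  exact ⟨k * l, mul_ne_zero hk hl, by rw [Matrix.smul_mul, Matrix.mul_smul, smul_smul]⟩

end Proportional

/-! ### Interpretation of the structural diagrams -/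

theorem interp_comp {a b d : ℕ} (D : Diagram a b) (E : Diagram b d) :
    interp (D ⨾ E) = interp E * interp D := by rw [interp]

theorem interp_comp_apply {a b d : ℕ} (D : Diagram a b) (E : Diagram b d) (y : Fin d → ZMod 3)
    (x : Fin a → ZMod 3) : interp (D ⨾ E) y x = ∑ z, interp E y z * interp D z x := by
  rw [interp, Matrix.mul_apply]

theorem interp_tensor {a b c d : ℕ} (D : Diagram a b) (E : Diagram c d)
    (y : Fin (b + d) → ZMod 3) (x : Fin (a + c) → ZMod 3) :
    interp (D ⊠ E) y x =
      interp D (fun i => y (Fin.castAdd d i)) (fun i => x (Fin.castAdd c i)) *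
        interp E (fun i => y (Fin.natAdd b i)) (fun i => x (Fin.natAdd a i)) := by
  rw [interp]

theorem interp_spider (c : Colour) (n m : ℕ) (α β : Real.Angle) (y : Fin m → ZMod 3)
    (x : Fin n → ZMod 3) : interp (.spider c n m α β) y x =
      ∑ j : ZMod 3, phaseCoeff α β j * (∏ i, ket c j (y i)) * (∏ i, star (ket c j (x i))) := by
  rw [interp]

theorem interp_cast {n n' m m' : ℕ} (hn : n = n') (hm : m = m') (D : Diagram n m)
    (y : Fin m' → ZMod 3) (x : Fin n' → ZMod 3) :
    interp (D.cast hn hm) y x = interp D (fun i => y (Fin.cast hm i)) (fun i => x (Fin.cast hn i)) := by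
  subst hn hm
  rfl

theorem sum_fin_add {m n : ℕ} {M : Type*} [AddCommMonoid M] (f : (Fin (m + n) → ZMod 3) → M) :
    ∑ z, f z = ∑ u : Fin m → ZMod 3, ∑ v : Fin n → ZMod 3, f (Fin.append u v) := by
  rw [← (Fin.appendEquiv m n).sum_comp, Fintype.sum_prod_type]
  rfl

/-- The matrix of the map that sends the basis vector `|x⟩` to `|x ∘ σ⟩`. -/
def wiring {n m : ℕ} (σ : Fin m → Fin n) : QMatrix n m := fun y x => if y = x ∘ σ then 1 else 0

theorem mul_wiring {n m k : ℕ} (σ : Fin m → Fin n) (A : QMatrix m k) (y : Fin k → ZMod 3)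
    (x : Fin n → ZMod 3) : (A * wiring σ) y x = A y (x ∘ σ) := by
  simp [Matrix.mul_apply, wiring]

theorem wiring_mul {n m k : ℕ} (σ : Fin m ≃ Fin n) (A : QMatrix k n) (y : Fin m → ZMod 3)
    (x : Fin k → ZMod 3) : (wiring σ * A) y x = A (y ∘ σ.symm) x := by
  have h : ∀ z : Fin n → ZMod 3, y = z ∘ σ ↔ z = y ∘ σ.symm := by
    intro z
    constructor
    · rintro rfl; ext; simp
    · rintro rfl; ext; simp
  simp [Matrix.mul_apply, wiring, h]

theorem wiring_mul_wiring {n m k : ℕ} (σ : Fin m → Fin n) (τ : Fin k → Fin m) :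
    wiring τ * wiring σ = wiring (σ ∘ τ) := by
  ext y x
  rw [mul_wiring]
  rfl

/-- Two permutations side by side. -/
def sumPerm {a b c d : ℕ} (σ : Fin b ≃ Fin a) (τ : Fin d ≃ Fin c) : Fin (b + d) ≃ Fin (a + c) :=
  finSumFinEquiv.symm.trans ((Equiv.sumCongr σ τ).trans finSumFinEquiv)

@[simp] theorem sumPerm_castAdd {a b c d : ℕ} (σ : Fin b ≃ Fin a) (τ : Fin d ≃ Fin c) (i : Fin b) :
    sumPerm σ τ (Fin.castAdd d i) = Fin.castAdd c (σ i) := by simp [sumPerm]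

@[simp] theorem sumPerm_natAdd {a b c d : ℕ} (σ : Fin b ≃ Fin a) (τ : Fin d ≃ Fin c) (i : Fin d) :
    sumPerm σ τ (Fin.natAdd b i) = Fin.natAdd a (τ i) := by simp [sumPerm]

theorem interp_tensor_wiring {a b c d : ℕ} {D : Diagram a b} {E : Diagram c d}
    {σ : Fin b ≃ Fin a} {τ : Fin d ≃ Fin c} (hD : interp D = wiring σ) (hE : interp E = wiring τ) :
    interp (D ⊠ E) = wiring (sumPerm σ τ) := by
  ext y x
  rw [interp_tensor, hD, hE]
  simp only [wiring, ← ite_and, mul_ite, mul_one, mul_zero]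
  congr 1
  simp only [funext_iff, eq_iff_iff, Function.comp_apply]
  constructor
  · rintro ⟨h1, h2⟩ i
    induction i using Fin.addCases with
    | left i => simp [h2]
    | right i => simp [h1]
  · intro h
    exact ⟨fun i => by simp [h], fun i => by simp [h]⟩

theorem interp_wire : interp wire = 1 := by rw [interp]

theorem interp_empty : interp empty = 1 := by rw [interp]

theorem one_eq_wiring (n : ℕ) : (1 : QMatrix n n) = wiring (Equiv.refl (Fin n)) := by
  ext y x
  simp [wiring, Matrix.one_apply]

theorem interp_tpow (D : Diagram 1 1) (n : ℕ) (y x : Fin n → ZMod 3) :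
    interp (tpow D n) y x = ∏ i, interp D (fun _ => y i) (fun _ => x i) := by
  induction n with
  | zero => simp [tpow, interp_empty, Subsingleton.elim y x]
  | succ n ih =>
    rw [tpow, interp_tensor, ih, Fin.prod_univ_castSucc]
    congr 1
    congr 1
    · ext i; rw [Subsingleton.elim i 0]; rfl
    · ext i; rw [Subsingleton.elim i 0]; rfl

theorem interp_ident (n : ℕ) : interp (ident n) = 1 := by
  ext y x
  rw [ident, interp_tpow, interp_wire]
  simp only [Matrix.one_apply, Finset.prod_ite_zero, Finset.prod_const_one, funext_iff]
  simp

theorem interp_swap : interp swap = wiring (Equiv.swap (0 : Fin 2) 1) := by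
  rw [interp]
  ext y x
  simp [wiring, funext_iff, Fin.forall_fin_two]

/-- Naturality of the symmetry needs only how the permutation moves the two blocks of wires, so it
is recorded through these two properties and not by a formula. -/
theorem interp_swapOne (n : ℕ) : ∃ σ : Fin (1 + n) ≃ Fin (n + 1),
    interp (swapOne n) = wiring σ ∧ (∀ i, σ (Fin.castAdd n i) = Fin.natAdd n i) ∧
      ∀ i, σ (Fin.natAdd 1 i) = Fin.castAdd 1 i := by
  induction n with
  | zero =>
    refine ⟨Equiv.refl _, ?_, ?_, fun i => i.elim0⟩
    · rw [swapOne]; exact interp_wire.trans (one_eq_wiring 1)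
    · intro i; ext; simp
  | succ n ih =>
    obtain ⟨σ, h, h0, h1⟩ := ih
    have e1 := interp_tensor_wiring ((interp_ident n).trans (one_eq_wiring n)) interp_swap
    have e2 := interp_tensor_wiring h (interp_wire.trans (one_eq_wiring 1))
    refine ⟨(@sumPerm (n + 1) (1 + n) 1 1 σ (Equiv.refl (Fin 1))).trans
      (@sumPerm n n 2 2 (Equiv.refl (Fin n)) (Equiv.swap (0 : Fin 2) 1)), ?_, ?_, ?_⟩
    · rw [swapOne, interp_comp]
      refine (congrArg₂ (· * ·) e2 e1).trans ?_
      exact wiring_mul_wiring (n := n + 2) (m := n + 2) (k := 1 + (n + 1)) _ _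
    · intro i
      have e1 := sumPerm_castAdd σ (Equiv.refl (Fin 1)) (Fin.castAdd n i)
      have e2 := sumPerm_natAdd (Equiv.refl (Fin n)) (Equiv.swap (0 : Fin 2) 1) 0
      rw [h0] at e1
      obtain rfl : i = 0 := Subsingleton.elim _ _
      exact (congrArg (@sumPerm n n 2 2 (Equiv.refl (Fin n)) (Equiv.swap (0 : Fin 2) 1)) e1).trans e2
    · intro i
      refine Fin.lastCases ?_ (fun i => ?_) i
      · have e1 := sumPerm_natAdd σ (Equiv.refl (Fin 1)) 0
        have e2 := sumPerm_natAdd (Equiv.refl (Fin n)) (Equiv.swap (0 : Fin 2) 1) 1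
        have e3 : Fin.natAdd 1 (Fin.last n) = Fin.natAdd (1 + n) (0 : Fin 1) := by
          ext; simp [Nat.add_comm]
        rw [e3]
        exact (congrArg (@sumPerm n n 2 2 (Equiv.refl (Fin n)) (Equiv.swap (0 : Fin 2) 1)) e1).trans
          e2
      · have e1 := sumPerm_castAdd σ (Equiv.refl (Fin 1)) (Fin.natAdd 1 i)
        have e2 := sumPerm_castAdd (Equiv.refl (Fin n)) (Equiv.swap (0 : Fin 2) 1) i
        rw [h1] at e1
        exact (congrArg (@sumPerm n n 2 2 (Equiv.refl (Fin n)) (Equiv.swap (0 : Fin 2) 1)) e1).trans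
          e2

/-! ### Soundness of the monoidal laws -/

theorem Proportional.tensor {a b c d : ℕ} {D D' : Diagram a b} {E E' : Diagram c d}
    (h : Proportional (interp D) (interp D')) (h' : Proportional (interp E) (interp E')) :
    Proportional (interp (D ⊠ E)) (interp (D' ⊠ E')) := by
  obtain ⟨k, hk, e⟩ := h
  obtain ⟨l, hl, e'⟩ := h'
  refine ⟨k * l, mul_ne_zero hk hl, ?_⟩
  ext y x
  rw [Matrix.smul_apply, interp_tensor, interp_tensor, e, e']
  simp only [Matrix.smul_apply, smul_eq_mul]
  ring

theorem interp_tensor_assoc {a b c d e f : ℕ} (D : Diagram a b) (E : Diagram c d)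
    (F : Diagram e f) :
    interp (((D ⊠ E) ⊠ F).cast (Nat.add_assoc a c e) (Nat.add_assoc b d f)) =
      interp (D ⊠ (E ⊠ F)) := by
  ext y x
  simp only [interp_cast, interp_tensor, mul_assoc]
  congr 1
  congr 1
  congr 1 <;> ext i <;> congr 1 <;> ext <;> simp [Nat.add_assoc]

theorem interp_empty_tensor {n m : ℕ} (D : Diagram n m) :
    interp ((empty ⊠ D).cast (Nat.zero_add n) (Nat.zero_add m)) = interp D := by
  ext y x
  simp only [interp_cast, interp_tensor, interp_empty]
  rw [Subsingleton.elim (fun i : Fin 0 => y _) (fun i : Fin 0 => x _), Matrix.one_apply_eq, one_mul]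
  congr 1 <;> ext i <;> congr 1 <;> ext <;> simp

theorem interp_tensor_empty {n m : ℕ} (D : Diagram n m) :
    interp ((D ⊠ empty).cast (Nat.add_zero n) (Nat.add_zero m)) = interp D := by
  ext y x
  simp only [interp_cast, interp_tensor, interp_empty]
  rw [Subsingleton.elim (fun i : Fin 0 => y _) (fun i : Fin 0 => x _), Matrix.one_apply_eq, mul_one]
  congr 1

theorem interp_interchange {a b c a' b' c' : ℕ} (D : Diagram a b) (E : Diagram b c)
    (D' : Diagram a' b') (E' : Diagram b' c') :
    interp ((D ⊠ D') ⨾ (E ⊠ E')) = interp ((D ⨾ E) ⊠ (D' ⨾ E')) := by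
  ext y x
  simp only [interp_comp_apply, interp_tensor, sum_fin_add, Fin.append_left, Fin.append_right,
    Finset.sum_mul_sum]
  refine Finset.sum_congr rfl fun u _ => Finset.sum_congr rfl fun v _ => ?_
  ring

theorem interp_swap_swap : interp (swap ⨾ swap) = interp (ident 2) := by
  rw [interp_comp, interp_swap, wiring_mul_wiring, interp_ident, one_eq_wiring]
  congr 1
  ext i
  simp

theorem interp_swap_natural {n m : ℕ} (D : Diagram n m) :
    interp ((D ⊠ wire) ⨾ swapOne m) = interp (swapOne n ⨾ (wire ⊠ D)) := by
  obtain ⟨σ, hσ, hσ0, hσ1⟩ := interp_swapOne m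
  obtain ⟨τ, hτ, hτ0, hτ1⟩ := interp_swapOne n
  have h0 : ∀ i, σ.symm (Fin.natAdd m i) = Fin.castAdd m i := fun i => by simp [← hσ0]
  have h1 : ∀ i, σ.symm (Fin.castAdd 1 i) = Fin.natAdd 1 i := fun i => by simp [← hσ1]
  ext y x
  rw [interp_comp, interp_comp, hσ, hτ, wiring_mul, mul_wiring, interp_tensor, interp_tensor,
    mul_comm]
  simp only [Function.comp_apply, h0, h1, hτ0, hτ1]

/-! ### Spiders as sums of product vectors -/

/-- The matrix `∑ⱼ cⱼ uⱼ^{⊗m} (vⱼ^{⊗n})ᵀ`. -/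
def spiderMatrix (n m : ℕ) (c : ZMod 3 → ℂ) (u v : ZMod 3 → ZMod 3 → ℂ) : QMatrix n m :=
  fun y x => ∑ j, c j * (∏ i, u j (y i)) * ∏ i, v j (x i)

/-- The matrix of a one-wire diagram. -/
noncomputable def entry (D : Diagram 1 1) : Matrix (ZMod 3) (ZMod 3) ℂ := fun k l =>
  interp D (fun _ => k) (fun _ => l)

theorem interp_spider_eq (c : Colour) (n m : ℕ) (α β : Real.Angle) :
    interp (.spider c n m α β) =
      spiderMatrix n m (phaseCoeff α β) (ket c) (fun j k => star (ket c j k)) := by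
  ext y x
  rw [interp_spider]
  rfl

/-- Each leg is acted on separately: expanding a product of sums over the legs as a sum over all
labellings turns the matrix product into a new vector on each leg. -/
theorem interp_tpow_mul_spiderMatrix (D : Diagram 1 1) (n m : ℕ) (c : ZMod 3 → ℂ)
    (u v : ZMod 3 → ZMod 3 → ℂ) : interp (tpow D m) * spiderMatrix n m c u v =
      spiderMatrix n m c (fun j k => ∑ l, entry D k l * u j l) v := by
  ext y x
  simp only [Matrix.mul_apply, spiderMatrix, Finset.mul_sum, interp_tpow]
  rw [Finset.sum_comm]
  refine Finset.sum_congr rfl fun j _ => ?_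
  rw [Finset.prod_univ_sum, Finset.mul_sum, Finset.sum_mul, Fintype.piFinset_univ]
  refine Finset.sum_congr rfl fun z _ => ?_
  rw [Finset.prod_mul_distrib]
  simp only [entry]
  ring

theorem spiderMatrix_mul_interp_tpow (D : Diagram 1 1) (n m : ℕ) (c : ZMod 3 → ℂ)
    (u v : ZMod 3 → ZMod 3 → ℂ) : spiderMatrix n m c u v * interp (tpow D n) =
      spiderMatrix n m c u (fun j k => ∑ l, v j l * entry D l k) := by
  ext y x
  simp only [Matrix.mul_apply, spiderMatrix, Finset.sum_mul, interp_tpow]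
  rw [Finset.sum_comm]
  refine Finset.sum_congr rfl fun j _ => ?_
  rw [Finset.prod_univ_sum, Finset.mul_sum, Fintype.piFinset_univ]
  refine Finset.sum_congr rfl fun z _ => ?_
  rw [Finset.prod_mul_distrib]
  simp only [entry]
  ring

theorem spiderMatrix_reindex (n m : ℕ) (e : ZMod 3 ≃ ZMod 3) (c : ZMod 3 → ℂ)
    (u v : ZMod 3 → ZMod 3 → ℂ) : spiderMatrix n m c u v =
      spiderMatrix n m (fun j => c (e j)) (fun j => u (e j)) (fun j => v (e j)) := by
  ext y x
  exact (e.sum_comp fun j => c j * (∏ i, u j (y i)) * ∏ i, v j (x i)).symm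

theorem spiderMatrix_smul_left (n m : ℕ) (a : ℂ) (c : ZMod 3 → ℂ) (u v : ZMod 3 → ZMod 3 → ℂ) :
    spiderMatrix n m c (fun j k => a * u j k) v = a ^ m • spiderMatrix n m c u v := by
  ext y x
  simp only [spiderMatrix, Matrix.smul_apply, smul_eq_mul, Finset.mul_sum, Finset.prod_mul_distrib,
    Finset.prod_const, Finset.card_univ, Fintype.card_fin]
  exact Finset.sum_congr rfl fun j _ => by ring

theorem spiderMatrix_smul_right (n m : ℕ) (a : ℂ) (c : ZMod 3 → ℂ) (u v : ZMod 3 → ZMod 3 → ℂ) :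
    spiderMatrix n m c u (fun j k => a * v j k) = a ^ n • spiderMatrix n m c u v := by
  ext y x
  simp only [spiderMatrix, Matrix.smul_apply, smul_eq_mul, Finset.mul_sum, Finset.prod_mul_distrib,
    Finset.prod_const, Finset.card_univ, Fintype.card_fin]
  exact Finset.sum_congr rfl fun j _ => by ring

theorem sum_fin_one {M : Type*} [AddCommMonoid M] (f : (Fin 1 → ZMod 3) → M) :
    ∑ z, f z = ∑ k, f (fun _ => k) :=
  ((Equiv.funUnique (Fin 1) (ZMod 3)).symm.sum_comp f).symm

theorem entry_comp (D E : Diagram 1 1) : entry (D ⨾ E) = entry E * entry D := by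
  ext k l
  rw [Matrix.mul_apply, entry, interp_comp_apply, sum_fin_one]
  rfl

theorem interp_eq_entry (D : Diagram 1 1) (y x : Fin 1 → ZMod 3) :
    interp D y x = entry D (y 0) (x 0) := by
  rw [entry]
  congr 1 <;> ext i <;> rw [Subsingleton.elim i 0]

theorem proportional_iff_entry {D E : Diagram 1 1} :
    Proportional (interp D) (interp E) ↔ ∃ k : ℂ, k ≠ 0 ∧ entry D = k • entry E := by
  refine exists_congr fun k => and_congr_right fun _ => ⟨fun h => ?_, fun h => ?_⟩
  · ext i j
    exact congrFun (congrFun h _) _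
  · ext y x
    rw [interp_eq_entry, h, Matrix.smul_apply, Matrix.smul_apply, interp_eq_entry E]

theorem interp_tpow_one (D : Diagram 1 1) : interp (tpow D 1) = interp D := by
  ext y x
  rw [interp_tpow, Fin.prod_univ_one, interp_eq_entry D y x]
  rfl

theorem entry_had (k l : ZMod 3) : entry had k l = ωpow (l * k) := by
  rw [entry, interp]
  simp [ket]

theorem entry_hadDag (k l : ZMod 3) : entry hadDag k l = ωpow (-(l * k)) := by
  rw [entry, interp]
  simp [ket, star_ωpow, mul_comm]

theorem entry_green (α β : Real.Angle) (k l : ZMod 3) :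
    entry (.spider .green 1 1 α β) k l = if k = l then phaseCoeff α β l else 0 := by
  rw [entry, interp_spider]
  simp [ket]

/-- For phases `(a, 2a)` the quadratic term of the exponent vanishes and a linear character remains,
so its Fourier transform is a translation. The values 1 and 2 of `a` give the nodes of K1 and K2. -/
theorem entry_red_translation (a : ZMod 3) (k l : ZMod 3) :
    entry (phase .red (a, 2 * a)) k l = if k + a = l then 3 else 0 := by
  have h : ∀ a j : ZMod 3, -(a + 2 * a) * j ^ 2 + (2 * a - a) * j = j * a := by decide
  rw [entry, phase, interp_spider]
  simp only [phaseCoeff_angle, h, ket, star_ωpow, Fin.prod_univ_one, ← ωpow_add]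
  have h' : ∀ j : ZMod 3, j * a + j * k + -(j * l) = j * (k + a - l) := fun j => by ring
  simp only [h', sum_ωpow_mul, sub_eq_zero]

/-! ### Soundness of the rules -/

theorem interp_green_fusion (a b k c d : ℕ) (α β η θ : Real.Angle) :
    interp (((spider .green a (b + (k + 1)) α β ⊠ ident c).cast rfl (Nat.add_assoc b (k + 1) c)) ⨾
          (ident b ⊠ spider .green ((k + 1) + c) d η θ)) =
      interp (spider .green (a + c) (b + d) (α + η) (β + θ)) := by
  -- The connecting wires contribute a product of `k + 1` overlaps of basis vectors. At least one
  -- wire is needed for this to vanish when `j ≠ j'`.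
  have key : ∀ j j' : ZMod 3, ∑ z : Fin (k + 1) → ZMod 3,
      (∏ i, ket .green j (z i)) * (∏ i, star (ket .green j' (z i))) = if j = j' then 1 else 0 := by
    intro j j'
    have h : ∀ j j' : ZMod 3, ∑ l, ket .green j l * star (ket .green j' l) =
        if j = j' then 1 else 0 := by
      intro j j'
      simp [ket, apply_ite, eq_comm]
    have h2 := Finset.prod_univ_sum (fun _ : Fin (k + 1) => (Finset.univ : Finset (ZMod 3)))
      (fun _ l => ket .green j l * star (ket .green j' l))
    simp only [h, Finset.prod_const, Finset.card_univ, Fintype.card_fin, Fintype.piFinset_univ,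
      Finset.prod_mul_distrib] at h2
    rw [← h2]
    split_ifs <;> simp
  generalize k + 1 = K at *
  ext y x
  have e : ∀ (u : Fin b → ZMod 3) (v : Fin K → ZMod 3) (w : Fin c → ZMod 3)
      (i : Fin (b + K + c)),
      Fin.append u (Fin.append v w) (Fin.cast (Nat.add_assoc b K c) i) =
        Fin.append (Fin.append u v) w i := by
    intro u v w i
    rw [Fin.append_assoc]
    rfl
  simp only [interp_comp_apply, interp_cast, interp_tensor, sum_fin_add, interp_ident,
    Matrix.one_apply, e, Fin.append_left, Fin.append_right, interp_spider, Fin.prod_univ_add,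
    ite_mul, mul_ite, one_mul, mul_one, zero_mul, mul_zero, phaseCoeff_add, Fin.cast_eq_self,
    Finset.sum_ite_eq', Finset.mem_univ, if_true]
  rw [Finset.sum_comm]
  simp only [Finset.sum_ite_eq, Finset.mem_univ, if_true, Finset.sum_mul_sum]
  rw [Finset.sum_comm]
  refine Finset.sum_congr rfl fun j _ => ?_
  rw [Finset.sum_comm]
  -- Multiplying `key` by all factors independent of the connecting wires lets the double sum over
  -- the two spiders' indices collapse to its diagonal.
  have h := fun j' => congrArg (fun t => phaseCoeff α β j' * phaseCoeff η θ j *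
    ((∏ i, ket .green j' (y (Fin.castAdd d i))) * ∏ i, ket .green j (y (Fin.natAdd b i))) *
    ((∏ i, star (ket .green j' (x (Fin.castAdd c i)))) *
      ∏ i, star (ket .green j (x (Fin.natAdd a i)))) * t) (key j' j)
  simp only [Finset.mul_sum, mul_ite, mul_one, mul_zero] at h
  rw [← Finset.sum_ite_eq' Finset.univ j (fun j' => phaseCoeff α β j' * phaseCoeff η θ j *
    ((∏ i, ket .green j' (y (Fin.castAdd d i))) * ∏ i, ket .green j (y (Fin.natAdd b i))) *
    ((∏ i, star (ket .green j' (x (Fin.castAdd c i)))) *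
      ∏ i, star (ket .green j (x (Fin.natAdd a i))))) |>.trans (if_pos (Finset.mem_univ j))]
  refine Finset.sum_congr rfl fun j' _ => ?_
  rw [← h j']
  refine Finset.sum_congr rfl fun z _ => ?_
  ring

theorem interp_spider_swap_out (n a b : ℕ) (c : Colour) (α β : Real.Angle) :
    interp (spider c n (a + 2 + b) α β ⨾ ((ident a ⊠ swap) ⊠ ident b)) =
      interp (spider c n (a + 2 + b) α β) := by
  have e := interp_tensor_wiring (interp_tensor_wiring ((interp_ident a).trans (one_eq_wiring a))
    interp_swap) ((interp_ident b).trans (one_eq_wiring b))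
  ext y x
  rw [interp_comp, e, wiring_mul, interp_spider, interp_spider]
  refine Finset.sum_congr rfl fun j _ => ?_
  congr 2
  exact Equiv.prod_comp (Equiv.symm _) fun i => ket c j (y i)

theorem interp_spider_swap_in (m a b : ℕ) (c : Colour) (α β : Real.Angle) :
    interp (((ident a ⊠ swap) ⊠ ident b) ⨾ spider c (a + 2 + b) m α β) =
      interp (spider c (a + 2 + b) m α β) := by
  have e := interp_tensor_wiring (interp_tensor_wiring ((interp_ident a).trans (one_eq_wiring a))
    interp_swap) ((interp_ident b).trans (one_eq_wiring b))
  ext y x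
  rw [interp_comp, e, mul_wiring, interp_spider, interp_spider]
  refine Finset.sum_congr rfl fun j _ => ?_
  congr 1
  exact Equiv.prod_comp _ fun i => star (ket c j (x i))

theorem interp_green_one_one : interp (spider .green 1 1 0 0) = interp wire := by
  ext y x
  rw [interp_eq_entry, interp_eq_entry wire, entry_green, phaseCoeff_zero_zero, entry, interp_wire,
    Matrix.one_apply]
  simp [funext_iff]

/-- The character sum enforces equality of the totals: up to 3, the phaseless red spider is addition
in `ZMod 3`. As green spiders copy basis vectors, B1 and B2 say that copying is compatible with zero
and with addition. -/
theorem interp_red_zero (n m : ℕ) (y : Fin m → ZMod 3) (x : Fin n → ZMod 3) :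
    interp (spider .red n m 0 0) y x = if ∑ i, y i = ∑ i, x i then 3 else 0 := by
  have hp : ∀ (j : ZMod 3) (k : ℕ) (z : Fin k → ZMod 3),
      ∏ i, ωpow (j * z i) = ωpow (j * ∑ i, z i) := by
    intro j k z
    induction k with
    | zero => simp
    | succ k ih => rw [Fin.prod_univ_succ, Fin.sum_univ_succ, ih, mul_add, ωpow_add]
  rw [interp_spider]
  simp only [phaseCoeff_zero_zero, ket, star_ωpow, ← mul_neg, hp, one_mul, ← ωpow_add, ← mul_add,
    sum_ωpow_mul, Finset.sum_neg_distrib, ← sub_eq_add_neg, sub_eq_zero]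

theorem interp_green_one_zero (m : ℕ) :
    interp (spider .green 1 m 0 0) = wiring fun _ => 0 := by
  ext y x
  rw [interp_spider]
  simp only [phaseCoeff_zero_zero, ket, Fin.prod_univ_one, one_mul, apply_ite star, star_one,
    star_zero, mul_ite, mul_one, mul_zero, Finset.sum_ite_eq, Finset.mem_univ, if_true]
  simp only [Finset.prod_ite_zero, Finset.prod_const_one, wiring, funext_iff, Function.comp_apply,
    Finset.mem_univ, forall_true_left]

theorem proportional_B1 : Proportional (interp (spider .red 0 1 0 0 ⨾ spider .green 1 2 0 0))
    (interp (spider .red 0 1 0 0 ⊠ spider .red 0 1 0 0)) := by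
  -- One red state on the left, two on the right, each contributing a factor 3.
  refine ⟨1 / 3, by norm_num, ?_⟩
  ext y x
  rw [interp_comp_apply, sum_fin_one, Matrix.smul_apply]
  refine Eq.trans ?_ (congrArg _ (interp_tensor (spider .red 0 1 0 0) (spider .red 0 1 0 0) y x)).symm
  simp only [interp_green_one_zero, interp_red_zero, wiring, Fin.sum_univ_one, Fin.sum_univ_zero]
  have e : Fin.natAdd 1 (0 : Fin 1) = (1 : Fin 2) := rfl
  have e' : Fin.castAdd 1 (0 : Fin 1) = (0 : Fin 2) := rfl
  simp only [funext_iff, Fin.forall_fin_two, Function.comp_apply, e, e', ite_mul, mul_ite, mul_zero,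
    one_mul, zero_mul, Finset.sum_ite_eq', Finset.mem_univ, if_true, smul_eq_mul]
  split_ifs <;> simp_all

theorem proportional_B2 : Proportional
    (interp (@comp 2 4 2
        (@comp 2 4 4 (spider .green 1 2 0 0 ⊠ spider .green 1 2 0 0)
          (@tensor 3 3 1 1 (wire ⊠ swap) wire))
        (spider .red 2 1 0 0 ⊠ spider .red 2 1 0 0)))
    (interp (spider .red 2 1 0 0 ⨾ spider .green 1 2 0 0)) := by
  -- Two red additions on the left against one on the right.
  refine ⟨3, by norm_num, ?_⟩
  have e1 : interp (spider .green 1 2 0 0 ⊠ spider .green 1 2 0 0) =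
      wiring (![0, 0, 1, 1] : Fin 4 → Fin 2) := by
    ext y x
    refine (interp_tensor _ _ y x).trans ?_
    simp only [interp_green_one_zero, wiring, funext_iff, Fin.forall_fin_two, Function.comp_apply,
      ← ite_and, mul_ite, mul_one, mul_zero]
    refine if_congr ?_ rfl rfl
    constructor
    · rintro ⟨h1, h2⟩ i
      fin_cases i
      exacts [h2.1, h2.2, h1.1, h1.2]
    · exact fun h => ⟨⟨h 2, h 3⟩, ⟨h 0, h 1⟩⟩
  have e2 := interp_tensor_wiring (interp_tensor_wiring (interp_wire.trans (one_eq_wiring 1))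
    interp_swap) (interp_wire.trans (one_eq_wiring 1))
  ext y x
  rw [interp_comp, interp_comp]
  refine (congrFun (congrFun (congrArg (interp _ * ·) (congrArg₂ (· * ·) e2 e1)) y) x).trans ?_
  refine (congrFun (congrFun (congrArg (interp _ * ·)
    (wiring_mul_wiring (n := 2) (m := 4) (k := 4) _ _)) y) x).trans ?_
  refine (mul_wiring (n := 2) (m := 4) (k := 2) _ _ y x).trans ?_
  rw [interp_comp, interp_green_one_zero, Matrix.smul_apply, Matrix.mul_apply]
  refine (interp_tensor (a := 2) (b := 1) (c := 2) (d := 1) _ _ y _).trans ?_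
  simp only [interp_red_zero, Fin.sum_univ_one, Fin.sum_univ_two, sum_fin_one]
  change (if y 0 = x 0 + x 1 then 3 else 0) * (if y 1 = x 0 + x 1 then 3 else 0) = _
  simp only [wiring, funext_iff, Fin.forall_fin_two, Function.comp_apply, mul_ite, mul_zero,
    Finset.sum_ite_eq', Finset.mem_univ, if_true, smul_eq_mul, ite_mul, one_mul, zero_mul]
  split_ifs <;> simp_all

theorem proportional_K1 (a : ZMod 3) (n : ℕ) :
    Proportional (interp (phase .red (a, 2 * a) ⨾ spider .green 1 n 0 0))
      (interp (spider .green 1 n 0 0 ⨾ tpow (phase .red (a, 2 * a)) n)) := by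
  have h3 : (3 : ℂ) ≠ 0 := by norm_num
  -- A red node is 3 times a translation: it acts on the one input on the left, on all `n` outputs
  -- on the right.
  refine ⟨3 / 3 ^ n, by positivity, ?_⟩
  rw [interp_comp, interp_comp, ← interp_tpow_one (phase _ _), interp_spider_eq,
    spiderMatrix_mul_interp_tpow, interp_tpow_mul_spiderMatrix,
    spiderMatrix_reindex _ _ (Equiv.addRight a) _ (fun j k => ∑ l, _)]
  have e1 : (fun j k : ZMod 3 => ∑ l, star (ket .green j l) * entry (phase .red (a, 2 * a)) l k) =
      fun j k => 3 * star (ket .green (j + a) k) := by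
    ext j k
    simp only [ket, entry_red_translation, apply_ite star, star_one, star_zero, ite_mul, one_mul,
      zero_mul, Finset.sum_ite_eq', Finset.mem_univ, if_true]
    simp only [mul_ite, mul_one, mul_zero, @eq_comm _ k (j + a)]
  have e2 : (fun j k : ZMod 3 => ∑ l, entry (phase .red (a, 2 * a)) k l *
      ket .green (j + a) l) = fun j k => 3 * ket .green j k := by
    ext j k
    simp [ket, entry_red_translation]
  have e3 : phaseCoeff 0 0 = fun _ => 1 := funext phaseCoeff_zero_zero
  simp only [Equiv.coe_addRight, e3]
  rw [e1, e2, spiderMatrix_smul_left, spiderMatrix_smul_right, smul_smul]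
  congr 1
  field_simp

/-- Moving a diagonal matrix past a translation shifts its entries. The scalar `k` renormalizes the
entry that lands at index 0, which a spider requires to be 1; hence `k` is `e^{iβ}` or `e^{iα}` in
the two applications. -/
theorem proportional_K2 (a : ZMod 3) (α β α' β' : Real.Angle) (k : ℂ) (hk : k ≠ 0)
    (h : ∀ j, phaseCoeff α β j = k * phaseCoeff α' β' (j + a)) :
    Proportional (interp (phase .red (a, 2 * a) ⨾ spider .green 1 1 α β))
      (interp (spider .green 1 1 α' β' ⨾ phase .red (a, 2 * a))) := by
  refine proportional_iff_entry.2 ⟨k, hk, ?_⟩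
  rw [entry_comp, entry_comp]
  ext i j
  simp only [Matrix.mul_apply, Matrix.smul_apply, entry_red_translation, entry_green, ite_mul,
    zero_mul, Finset.sum_ite_eq, Finset.mem_univ, if_true, smul_eq_mul, h]
  split_ifs with hij
  · rw [hij]; ring
  · ring

theorem proportional_K2_12 (α β : Real.Angle) :
    Proportional (interp (phase .red (1, 2) ⨾ spider .green 1 1 α β))
      (interp (spider .green 1 1 (-β) (α - β) ⨾ phase .red (1, 2))) := by
  refine proportional_K2 1 _ _ _ _ β.toCircle (by simp) fun j => ?_
  have h1 : (1 + 1 : ZMod 3) = 2 := by decide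
  have h2 : (2 + 1 : ZMod 3) = 0 := by decide
  have h3 : (2 : ZMod 3) ≠ 0 := by decide
  have h4 : (2 : ZMod 3) ≠ 1 := by decide
  rcases zmod_three_cases j with rfl | rfl | rfl <;>
    simp [phaseCoeff, h1, h2, h3, h4, sub_eq_add_neg, Real.Angle.toCircle_add,
      Real.Angle.toCircle_neg]
  field_simp

theorem proportional_K2_21 (α β : Real.Angle) :
    Proportional (interp (phase .red (2, 1) ⨾ spider .green 1 1 α β))
      (interp (spider .green 1 1 (β - α) (-α) ⨾ phase .red (2, 1))) := by
  refine proportional_K2 2 _ _ _ _ α.toCircle (by simp) fun j => ?_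
  have h1 : (1 + 2 : ZMod 3) = 0 := by decide
  have h2 : (2 + 2 : ZMod 3) = 1 := by decide
  have h3 : (2 : ZMod 3) ≠ 0 := by decide
  have h4 : (2 : ZMod 3) ≠ 1 := by decide
  rcases zmod_three_cases j with rfl | rfl | rfl <;>
    simp [phaseCoeff, h1, h2, h3, h4, sub_eq_add_neg, Real.Angle.toCircle_add,
      Real.Angle.toCircle_neg]
  field_simp

theorem proportional_of_entry {D E : Diagram 1 1} (k : ℂ) (hk : k ≠ 0)
    (h : ∀ i j, entry D i j = k * entry E i j) : Proportional (interp D) (interp E) :=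
  proportional_iff_entry.2 ⟨k, hk, by ext i j; exact h i j⟩

theorem entry_wire (i j : ZMod 3) : entry wire i j = if i = j then 1 else 0 := by
  rw [entry, interp_wire, Matrix.one_apply]
  simp [funext_iff]

theorem proportional_H1_left : Proportional (interp (had ⨾ hadDag)) (interp wire) := by
  refine proportional_of_entry 3 (by norm_num) fun i j => ?_
  have h : ∀ l : ZMod 3, -(l * i) + j * l = l * (j - i) := fun l => by ring
  simp only [entry_comp, Matrix.mul_apply, entry_had, entry_hadDag, entry_wire, ← ωpow_add, h,
    sum_ωpow_mul, sub_eq_zero, @eq_comm _ j i, mul_ite, mul_one, mul_zero]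

theorem proportional_H1_right : Proportional (interp (hadDag ⨾ had)) (interp wire) := by
  refine proportional_of_entry 3 (by norm_num) fun i j => ?_
  have h : ∀ l : ZMod 3, l * i + -(j * l) = l * (i - j) := fun l => by ring
  simp only [entry_comp, Matrix.mul_apply, entry_had, entry_hadDag, entry_wire, ← ωpow_add, h,
    sum_ωpow_mul, sub_eq_zero, mul_ite, mul_one, mul_zero]

theorem interp_H2 (n m : ℕ) (α β : Real.Angle) :
    interp (tpow hadDag n ⨾ spider .green n m α β ⨾ tpow had m) = interp (spider .red n m α β) := by
  rw [interp_comp, interp_comp, interp_spider_eq, interp_spider_eq, ← Matrix.mul_assoc,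
    interp_tpow_mul_spiderMatrix, spiderMatrix_mul_interp_tpow]
  congr 1 <;> ext j k <;>
    simp [ket, entry_had, entry_hadDag, star_ωpow, apply_ite star, mul_comm]

theorem interp_H2' (n m : ℕ) (α β : Real.Angle) :
    interp (tpow had n ⨾ spider .green n m α β ⨾ tpow hadDag m) = interp (spider .red n m β α) := by
  rw [interp_comp, interp_comp, interp_spider_eq, interp_spider_eq, ← Matrix.mul_assoc,
    interp_tpow_mul_spiderMatrix, spiderMatrix_mul_interp_tpow,
    spiderMatrix_reindex _ _ (Equiv.neg _) (phaseCoeff β α)]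
  congr 1
  · ext j
    simp [phaseCoeff_swap]
  all_goals
    ext j k
    simp [ket, entry_had, entry_hadDag, star_ωpow, apply_ite star, mul_comm]

/-- This is the quadratic Gauss sum of `ω^(-l²)`, whose square is -3. -/
theorem gaussSum_ne_zero : 1 + 2 * ω ^ 2 ≠ 0 := by
  intro h
  have hc : (1 + 2 * ω ^ 2) * (1 + 2 * ω ^ 2) = -3 := by
    linear_combination 4 * ω_quadratic + 4 * ω * ω_pow_three
  rw [h] at hc
  norm_num at hc

theorem entry_red_two_two (i j : ZMod 3) :
    entry (phase .red (2, 2)) i j = ωpow ((i - j) ^ 2) * (1 + 2 * ω ^ 2) := by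
  have h : ∀ i j l : ZMod 3, -(2 + 2) * l ^ 2 + (2 - 2) * l + l * i + -(l * j) =
      -l ^ 2 + l * (i - j) := by decide
  rw [entry, phase, interp_spider]
  simp only [phaseCoeff_angle, ket, star_ωpow, Fin.prod_univ_one, ← ωpow_add, h]
  generalize i - j = d
  -- Completing the square; the shift by `d` then disappears from the sum over `l`.
  have h1 : ∀ d l : ZMod 3, -l ^ 2 + l * d = d ^ 2 + -(l + d) ^ 2 := by decide
  simp only [h1, ωpow_add (d ^ 2), ← Finset.mul_sum]
  congr 1
  refine (Equiv.sum_comp (Equiv.addRight d) fun l => ωpow (-l ^ 2)).trans ?_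
  rw [sum_zmod_three]
  have h2 : (-1 ^ 2 : ZMod 3) = 2 := by decide
  have h3 : (-2 ^ 2 : ZMod 3) = 2 := by decide
  have h4 : (-0 ^ 2 : ZMod 3) = 0 := by decide
  rw [h2, h3, h4, ωpow_zero, ωpow_two]
  ring

theorem proportional_EU : Proportional (interp had)
    (interp (phase .green (2, 2) ⨾ phase .red (2, 2) ⨾ phase .green (2, 2))) := by
  refine proportional_of_entry (1 + 2 * ω ^ 2)⁻¹ (inv_ne_zero gaussSum_ne_zero) fun i j => ?_
  have hg : ∀ i j, entry (phase .green (2, 2)) i j = if i = j then ωpow (-j ^ 2) else 0 := by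
    have h : ∀ l : ZMod 3, -(2 + 2) * l ^ 2 + (2 - 2) * l = -l ^ 2 := by decide
    intro i j
    rw [phase, entry_green, phaseCoeff_angle, h]
  -- Polarization modulo 3, where -2 = 1: the Fourier kernel is a Gaussian convolution between two
  -- Gaussian multiplications.
  have h : ∀ i j : ZMod 3, j * i = -i ^ 2 + ((i - j) ^ 2 + -j ^ 2) := by decide
  simp only [entry_comp, Matrix.mul_apply, hg, entry_had, entry_red_two_two, ite_mul, zero_mul,
    mul_ite, mul_zero, Finset.sum_ite_eq, Finset.sum_ite_eq', Finset.mem_univ, if_true]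
  rw [h, ωpow_add, ωpow_add]
  field_simp [gaussSum_ne_zero]

theorem sum_fin_three {M : Type*} [AddCommMonoid M] (f : (Fin 3 → ZMod 3) → M) :
    ∑ z, f z = ∑ a, ∑ b, ∑ c, f ![a, b, c] := by
  refine (sum_fin_add (m := 1) (n := 2) f).trans ?_
  rw [sum_fin_one]
  refine Finset.sum_congr rfl fun a _ => ?_
  refine (sum_fin_add (m := 1) (n := 1) _).trans ?_
  rw [sum_fin_one]
  refine Finset.sum_congr rfl fun b _ => ?_
  rw [sum_fin_one]
  refine Finset.sum_congr rfl fun c _ => ?_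
  congr 1
  ext i
  fin_cases i <;> rfl

/-- Only the middle wire, labelled `a`, stays summed; the outer two are pinned to input and output.
In P1 one bend forces equality of labels and the other forces them to sum to 0, which gives
negation. -/
theorem entry_bend (D : Diagram 0 2) (E : Diagram 2 0) (i j : ZMod 3) :
    entry ((wire ⊠ D) ⨾ (E ⊠ wire) : Diagram 1 1) i j =
      ∑ a, interp E ![] ![j, a] * interp D ![a, i] ![] := by
  have h1 : ∀ a b c : ZMod 3, interp (wire ⊠ D) ![a, b, c] (fun _ => j) =
      if a = j then interp D ![b, c] ![] else 0 := by
    intro a b c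
    refine (interp_tensor _ _ _ _).trans ?_
    rw [interp_wire, Matrix.one_apply, ite_mul, one_mul, zero_mul]
    congr 1
    · simp [funext_iff]
    · congr 1
      · ext k; fin_cases k <;> rfl
      · exact Subsingleton.elim _ _
  have h2 : ∀ a b c : ZMod 3, interp (E ⊠ wire) (fun _ => i) ![a, b, c] =
      if i = c then interp E ![] ![a, b] else 0 := by
    intro a b c
    refine (interp_tensor _ _ _ _).trans ?_
    rw [interp_wire, Matrix.one_apply, mul_ite, mul_one, mul_zero]
    congr 1
    · simp [funext_iff]
    · congr 1
      · exact Subsingleton.elim _ _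
      · ext k; fin_cases k <;> rfl
  rw [entry, interp_comp_apply]
  refine (sum_fin_three _).trans ?_
  refine (Finset.sum_congr rfl fun a _ => Finset.sum_congr rfl fun b _ =>
    Finset.sum_congr rfl fun c _ => congrArg₂ (· * ·) (h2 a b c) (h1 a b c)).trans ?_
  simp

theorem interp_green_cap (y : Fin 2 → ZMod 3) (x : Fin 0 → ZMod 3) :
    interp (.spider .green 0 2 0 0) y x = if y 0 = y 1 then 1 else 0 := by
  rw [interp_spider]
  simp [phaseCoeff_zero_zero, ket]

theorem interp_green_cup (y : Fin 0 → ZMod 3) (x : Fin 2 → ZMod 3) :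
    interp (.spider .green 2 0 0 0) y x = if x 0 = x 1 then 1 else 0 := by
  rw [interp_spider]
  simp [phaseCoeff_zero_zero, ket]

theorem proportional_P1_had : Proportional (interp (had ⨾ had))
    (interp ((wire ⊠ spider .green 0 2 0 0) ⨾ (spider .red 2 0 0 0 ⊠ wire) : Diagram 1 1)) := by
  refine proportional_of_entry 1 one_ne_zero fun i j => ?_
  have h : ∀ l : ZMod 3, l * i + j * l = l * (i + j) := fun l => by ring
  have h' : ∀ a : ZMod 3, (∑ k, (![j, a] : Fin 2 → ZMod 3) k) = j + a := fun a => by simp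
  have hc : ∀ a, interp (.spider .green 0 2 0 0) ![a, i] ![] = if a = i then 1 else 0 :=
    fun a => interp_green_cap _ _
  rw [entry_bend, one_mul]
  simp only [entry_comp, Matrix.mul_apply, entry_had, ← ωpow_add, h, sum_ωpow_mul, interp_red_zero,
    hc, h', Finset.univ_eq_empty, Finset.sum_empty]
  simp only [mul_ite, mul_one, mul_zero, Finset.sum_ite_eq', Finset.mem_univ, if_true,
    add_comm j i, @eq_comm _ 0 (i + j)]

theorem proportional_P1_hadDag : Proportional (interp (hadDag ⨾ hadDag))
    (interp ((wire ⊠ spider .red 0 2 0 0) ⨾ (spider .green 2 0 0 0 ⊠ wire) : Diagram 1 1)) := by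
  refine proportional_of_entry 1 one_ne_zero fun i j => ?_
  have h : ∀ l : ZMod 3, -(l * i) + -(j * l) = l * -(i + j) := fun l => by ring
  have h' : ∀ a : ZMod 3, (∑ k, (![a, i] : Fin 2 → ZMod 3) k) = a + i := fun a => by simp
  have hc : ∀ a, interp (.spider .green 2 0 0 0) ![] ![j, a] = if j = a then 1 else 0 :=
    fun a => interp_green_cup _ _
  rw [entry_bend, one_mul]
  simp only [entry_comp, Matrix.mul_apply, entry_hadDag, ← ωpow_add, h, sum_ωpow_mul,
    interp_red_zero, hc, h', Finset.univ_eq_empty, Finset.sum_empty, neg_eq_zero]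
  simp only [ite_mul, one_mul, zero_mul, Finset.sum_ite_eq, Finset.mem_univ, if_true,
    add_comm j i]

/-! ### Soundness -/

theorem Derivable.sound {n m : ℕ} {D E : Diagram n m} (h : Derivable D E) :
    Proportional (interp D) (interp E) := by
  induction h with
  | refl D => exact .of_eq rfl
  | symm _ ih => exact ih.symm
  | trans _ _ ih ih' => exact ih.trans ih'
  | comp_congr _ _ ih ih' =>
    rw [interp_comp, interp_comp]
    exact ih'.mul ih
  | tensor_congr _ _ ih ih' => exact ih.tensor ih'
  | comp_assoc D E F => exact .of_eq (by simp only [interp_comp, Matrix.mul_assoc])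
  | id_comp D => exact .of_eq (by rw [interp_comp, interp_ident, Matrix.mul_one])
  | comp_id D => exact .of_eq (by rw [interp_comp, interp_ident, Matrix.one_mul])
  | tensor_assoc D E F => exact .of_eq (interp_tensor_assoc D E F)
  | empty_tensor D => exact .of_eq (interp_empty_tensor D)
  | tensor_empty D => exact .of_eq (interp_tensor_empty D)
  | interchange D E D' E' => exact .of_eq (interp_interchange D E D' E')
  | swap_swap => exact .of_eq interp_swap_swap
  | swap_natural D => exact .of_eq (interp_swap_natural D)
  | S1 a b k c d α β η θ => exact .of_eq (interp_green_fusion a b k c d α β η θ)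
  | S2 => exact .of_eq interp_green_one_one
  | S3_out n a b α β => exact .of_eq (interp_spider_swap_out n a b _ α β)
  | S3_in m a b α β => exact .of_eq (interp_spider_swap_in m a b _ α β)
  | B1 => exact proportional_B1
  | B2 => exact proportional_B2
  | K1_12 n => exact proportional_K1 1 n
  | K1_21 n => exact proportional_K1 2 n
  | K2_12 α β => exact proportional_K2_12 α β
  | K2_21 α β => exact proportional_K2_21 α β
  | H1_left => exact proportional_H1_left
  | H1_right => exact proportional_H1_right
  | EU => exact proportional_EU
  | H2 n m α β => exact .of_eq (interp_H2 n m α β)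
  | H2' n m α β => exact .of_eq (interp_H2' n m α β)
  | P1_had => exact proportional_P1_had
  | P1_hadDag => exact proportional_P1_hadDag

/-! ### A group of order at most 216 -/

/-- The relations between a green node `s` with phases `(2,2)`, a green node `z` with phases `(1,2)`
and the Hadamard node `h` that present the single-qutrit Clifford group modulo scalars. -/
structure CliffordRelations {G : Type*} [Group G] (s z h : G) : Prop where
  s_pow : s ^ 3 = 1
  z_pow : z ^ 3 = 1
  comm : s * z = z * s
  euler : h = s * (h⁻¹ * s * h) * s
  conj_s : h * s * h⁻¹ = h⁻¹ * s * h
  conj_z : h * z * h⁻¹ = (h⁻¹ * z * h)⁻¹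
  shear : (h⁻¹ * z * h) * s = s * z ^ 2 * (h⁻¹ * z * h)
  weyl : (h⁻¹ * z * h) * z = z * (h⁻¹ * z * h)

namespace CliffordRelations

/-- Conjugation by `h` and by `h⁻¹` agree on `s`, so conjugation by `h²` fixes it. -/
theorem commute_sq_s {G : Type*} [Group G] {s z h : G} (R : CliffordRelations s z h) :
    Commute (h ^ 2) s := by
  calc h ^ 2 * s = h * (h * s * h⁻¹) * h := by simp [pow_two, mul_assoc]
    _ = h * (h⁻¹ * s * h) * h := by rw [R.conj_s]
    _ = s * h ^ 2 := by simp [pow_two, mul_assoc]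

theorem inv_h_s_h {G : Type*} [Group G] {s z h : G} (R : CliffordRelations s z h) :
    h⁻¹ * s * h = s⁻¹ * h * s⁻¹ := by
  calc h⁻¹ * s * h = s⁻¹ * (s * (h⁻¹ * s * h) * s) * s⁻¹ := by group
    _ = s⁻¹ * h * s⁻¹ := by rw [← R.euler]

theorem h_s_h {G : Type*} [Group G] {s z h : G} (R : CliffordRelations s z h) :
    h * s * h = s⁻¹ * h * s⁻¹ * h ^ 2 := by
  calc h * s * h = h * s * h⁻¹ * h ^ 2 := by simp [pow_two, mul_assoc]
    _ = s⁻¹ * h * s⁻¹ * h ^ 2 := by rw [R.conj_s, R.inv_h_s_h]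

/-- Obtained by inverting `h_s_h` and using that `h²` commutes with `s`. -/
theorem h_s_inv_h {G : Type*} [Group G] {s z h : G} (R : CliffordRelations s z h) :
    h * s⁻¹ * h = s * h * s := by
  calc h * s⁻¹ * h = h ^ 2 * (h * s * h)⁻¹ * h ^ 2 := by simp [pow_two, mul_assoc]
    _ = s * h⁻¹ * (s * h ^ 2) := by rw [R.h_s_h]; simp [mul_assoc]
    _ = s * h * s := by rw [← R.commute_sq_s.eq]; simp [pow_two, mul_assoc]

theorem s_inv {G : Type*} [Group G] {s z h : G} (R : CliffordRelations s z h) : s⁻¹ = s * s :=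
  inv_eq_of_mul_eq_one_right (by rw [← mul_assoc, ← pow_three', R.s_pow])

/-- With `s⁻¹ = s²`, the element `h s⁻¹ h` can be computed in a second way, as `(h s h)(h⁻¹ s h)`.
This differs from the value in `h_s_inv_h` by exactly the factor `h⁴`. -/
theorem h_pow_four {G : Type*} [Group G] {s z h : G} (R : CliffordRelations s z h) :
    (h ^ 2) ^ 2 = 1 := by
  have c := R.commute_sq_s.inv_right.eq
  have ch : h ^ 2 * h = h * h ^ 2 := by simp [pow_two, mul_assoc]
  have e : s⁻¹ * s⁻¹ = s := by rw [← mul_inv_rev, ← R.s_inv, inv_inv]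
  have key : h * s⁻¹ * h = (h ^ 2) ^ 2 * (s * h * s) := by
    calc h * s⁻¹ * h = (h * s * h) * (h⁻¹ * s * h) := by rw [R.s_inv]; simp [mul_assoc]
      _ = s⁻¹ * h * s⁻¹ * h ^ 2 * (s⁻¹ * h * s⁻¹) := by rw [R.h_s_h, R.inv_h_s_h]
      _ = s⁻¹ * h * s⁻¹ * (h ^ 2 * s⁻¹) * h * s⁻¹ := by simp only [mul_assoc]
      _ = s⁻¹ * h * (s⁻¹ * s⁻¹) * (h ^ 2 * h) * s⁻¹ := by rw [c]; simp only [mul_assoc]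
      _ = s⁻¹ * (h * s * h) * (h ^ 2 * s⁻¹) := by rw [e, ch]; simp only [mul_assoc]
      _ = s⁻¹ * s⁻¹ * h * s⁻¹ * h ^ 2 * (h ^ 2 * s⁻¹) := by rw [R.h_s_h]; simp only [mul_assoc]
      _ = s * h * s⁻¹ * ((h ^ 2) ^ 2 * s⁻¹) := by rw [e, pow_two (h ^ 2)]; simp only [mul_assoc]
      _ = s * h * (s⁻¹ * s⁻¹) * (h ^ 2) ^ 2 := by
        rw [(R.commute_sq_s.inv_right.pow_left 2).eq]; simp only [mul_assoc]
      _ = s * (h * (h ^ 2) ^ 2) * s := by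
        rw [e, mul_assoc, ← (R.commute_sq_s.pow_left 2).eq]; simp only [mul_assoc]
      _ = s * ((h ^ 2) ^ 2) * h * s := by
        rw [(((Commute.refl h).pow_right 2).pow_right 2).eq]; simp only [mul_assoc]
      _ = (h ^ 2) ^ 2 * (s * h * s) := by
        rw [← (R.commute_sq_s.pow_left 2).eq]; simp only [mul_assoc]
  rw [R.h_s_inv_h] at key
  exact (mul_eq_right.1 key.symm)

end CliffordRelations

/-- The elements `zⁱ xʲ sᵃ h²ᵉ` and `zⁱ xʲ sᵃ h²ᵉ h sᵇ` with `x = h⁻¹ z h`. -/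
def cliffordWord {G : Type*} [Group G] (s z h : G) :
    Fin 3 × Fin 3 × Fin 3 × Fin 2 × Option (Fin 3) → G
  | (i, j, a, e, none) =>
    z ^ (i : ℕ) * (h⁻¹ * z * h) ^ (j : ℕ) * s ^ (a : ℕ) * (h ^ 2) ^ (e : ℕ)
  | (i, j, a, e, some b) =>
    z ^ (i : ℕ) * (h⁻¹ * z * h) ^ (j : ℕ) * s ^ (a : ℕ) * (h ^ 2) ^ (e : ℕ) * (h * s ^ (b : ℕ))

namespace CliffordRelations

theorem pow_val {G : Type*} [Group G] {g : G} {n : ℕ} [NeZero n] (hg : g ^ n = 1) (i : ℕ) :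
    g ^ ((Fin.ofNat n i : Fin n) : ℕ) = g ^ i := by
  rw [Fin.val_ofNat, ← pow_eq_pow_mod _ hg]

theorem conj_z_pow {G : Type*} [Group G] {s z h : G} (R : CliffordRelations s z h) :
    (h⁻¹ * z * h) ^ 3 = 1 := by
  have := conj_pow (i := 3) (a := h⁻¹) (b := z)
  rw [inv_inv] at this
  rw [this, R.z_pow]
  simp

/-- Natural exponents and an abstract last factor `t` let left multiplication be computed without
reducing exponents and, for `z` and `s`, without separating the two Bruhat cells. -/
theorem word_mem_range {G : Type*} [Group G] {s z h : G} (R : CliffordRelations s z h)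
    (i j a e : ℕ) (t : G) (ht : t = 1 ∨ ∃ b : ℕ, t = h * s ^ b) :
    z ^ i * (h⁻¹ * z * h) ^ j * s ^ a * (h ^ 2) ^ e * t ∈ Set.range (cliffordWord s z h) := by
  rcases ht with rfl | ⟨b, rfl⟩
  · exact ⟨(Fin.ofNat 3 i, Fin.ofNat 3 j, Fin.ofNat 3 a, Fin.ofNat 2 e, none), by
      rw [cliffordWord, pow_val R.z_pow, pow_val R.conj_z_pow, pow_val R.s_pow,
        pow_val R.h_pow_four, mul_one]⟩
  · exact ⟨(Fin.ofNat 3 i, Fin.ofNat 3 j, Fin.ofNat 3 a, Fin.ofNat 2 e, some (Fin.ofNat 3 b)), by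
      rw [cliffordWord, pow_val R.z_pow, pow_val R.conj_z_pow, pow_val R.s_pow,
        pow_val R.h_pow_four, pow_val R.s_pow]⟩

theorem exists_of_mem_range {G : Type*} [Group G] {s z h g : G}
    (hg : g ∈ Set.range (cliffordWord s z h)) :
    ∃ (i j a e : ℕ) (t : G), (t = 1 ∨ ∃ b : ℕ, t = h * s ^ b) ∧
      g = z ^ i * (h⁻¹ * z * h) ^ j * s ^ a * (h ^ 2) ^ e * t := by
  obtain ⟨⟨i, j, a, e, b⟩, rfl⟩ := hg
  rcases b with _ | b
  · exact ⟨i, j, a, e, 1, .inl rfl, by rw [cliffordWord, mul_one]⟩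
  · exact ⟨i, j, a, e, _, .inr ⟨b, rfl⟩, rfl⟩

theorem z_mul_mem {G : Type*} [Group G] {s z h : G} (R : CliffordRelations s z h) {g : G}
    (hg : g ∈ Set.range (cliffordWord s z h)) : z * g ∈ Set.range (cliffordWord s z h) := by
  obtain ⟨i, j, a, e, t, ht, rfl⟩ := exists_of_mem_range hg
  convert R.word_mem_range (i + 1) j a e t ht using 1
  simp only [pow_succ', mul_assoc]

/-- The shear relation amounts to `s x = z x s`; as `x` and `z` commute, the factors `z` collect on
the left. -/
theorem s_mul_pow {G : Type*} [Group G] {s z h : G} (R : CliffordRelations s z h) (j : ℕ) :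
    s * (h⁻¹ * z * h) ^ j = z ^ j * (h⁻¹ * z * h) ^ j * s := by
  have hx := R.shear
  have hw : Commute (h⁻¹ * z * h) z := R.weyl
  generalize h⁻¹ * z * h = x at *
  have h1 : s * x = z * x * s := by
    calc s * x = s * z ^ 3 * x := by rw [R.z_pow, mul_one]
      _ = s * z * z ^ 2 * x := by rw [pow_succ' z 2]; simp only [mul_assoc]
      _ = z * (x * s) := by rw [hx, R.comm]; simp only [mul_assoc]
      _ = z * x * s := (mul_assoc _ _ _).symm
  induction j with
  | zero => simp
  | succ j ih =>
    calc s * x ^ (j + 1) = s * x ^ j * x := by rw [pow_succ, mul_assoc]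
      _ = z ^ j * x ^ j * (z * x * s) := by rw [ih, mul_assoc, h1]
      _ = z ^ j * (x ^ j * z) * x * s := by simp only [mul_assoc]
      _ = z ^ (j + 1) * x ^ (j + 1) * s := by
        rw [(hw.pow_left j).eq, pow_succ, pow_succ]; simp only [mul_assoc]

theorem s_mul_mem {G : Type*} [Group G] {s z h : G} (R : CliffordRelations s z h) {g : G}
    (hg : g ∈ Set.range (cliffordWord s z h)) : s * g ∈ Set.range (cliffordWord s z h) := by
  obtain ⟨i, j, a, e, t, ht, rfl⟩ := exists_of_mem_range hg
  convert R.word_mem_range (i + j) j (a + 1) e t ht using 1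
  have hc : Commute s z := R.comm
  calc s * (z ^ i * (h⁻¹ * z * h) ^ j * s ^ a * (h ^ 2) ^ e * t)
      = s * z ^ i * (h⁻¹ * z * h) ^ j * s ^ a * (h ^ 2) ^ e * t := by simp only [mul_assoc]
    _ = z ^ i * (s * (h⁻¹ * z * h) ^ j) * s ^ a * (h ^ 2) ^ e * t := by
      rw [(hc.pow_right i).eq]; simp only [mul_assoc]
    _ = z ^ (i + j) * (h⁻¹ * z * h) ^ j * s ^ (a + 1) * (h ^ 2) ^ e * t := by
      rw [R.s_mul_pow, pow_add z, pow_succ' s]; simp only [mul_assoc]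

/-- Conjugation by `h` sends `x` to `z` and `z` to `x⁻¹ = x²`, which explains the exponent `2 * i`.
-/
theorem h_mul_pow {G : Type*} [Group G] {s z h : G} (R : CliffordRelations s z h) (i j : ℕ) :
    h * (z ^ i * (h⁻¹ * z * h) ^ j) = z ^ j * (h⁻¹ * z * h) ^ (2 * i) * h := by
  have e1 : h * z ^ i * h⁻¹ = (h⁻¹ * z * h) ^ (2 * i) := by
    rw [← conj_pow, R.conj_z, pow_mul]
    congr 1
    exact inv_eq_of_mul_eq_one_right (by rw [← pow_succ', R.conj_z_pow])
  have e2 : h * (h⁻¹ * z * h) ^ j * h⁻¹ = z ^ j := by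
    rw [← conj_pow]
    simp [mul_assoc]
  have hw : Commute (h⁻¹ * z * h) z := R.weyl
  calc h * (z ^ i * (h⁻¹ * z * h) ^ j)
      = (h * z ^ i * h⁻¹) * (h * (h⁻¹ * z * h) ^ j * h⁻¹) * h := by
        generalize (h⁻¹ * z * h) ^ j = y
        simp [mul_assoc]
    _ = z ^ j * (h⁻¹ * z * h) ^ (2 * i) * h := by rw [e1, e2, (hw.pow_pow (2 * i) j).eq]

theorem h_mul_mem {G : Type*} [Group G] {s z h : G} (R : CliffordRelations s z h) {g : G}
    (hg : g ∈ Set.range (cliffordWord s z h)) : h * g ∈ Set.range (cliffordWord s z h) := by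
  obtain ⟨i, j, a, e, t, ht, rfl⟩ := exists_of_mem_range hg
  have hcs := fun n : ℕ => (R.commute_sq_s.pow_left e).pow_right n
  have hch : Commute ((h ^ 2) ^ e) h := ((Commute.refl h).pow_left 2).pow_left e
  have e0 : h * (z ^ i * (h⁻¹ * z * h) ^ j * s ^ a * (h ^ 2) ^ e * t) =
      z ^ j * (h⁻¹ * z * h) ^ (2 * i) * (h * s ^ a * ((h ^ 2) ^ e * t)) := by
    calc _ = h * (z ^ i * (h⁻¹ * z * h) ^ j) * (s ^ a * (h ^ 2) ^ e * t) := by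
          simp only [mul_assoc]
      _ = _ := by rw [R.h_mul_pow]; simp only [mul_assoc]
  rw [e0]
  rcases ht with rfl | ⟨b, rfl⟩
  · convert R.word_mem_range j (2 * i) 0 e (h * s ^ a) (.inr ⟨a, rfl⟩) using 1
    rw [mul_one, pow_zero, mul_one, mul_assoc (z ^ j * _), ((hch.mul_right (hcs a))).eq]
  · have e1 : h * s ^ a * ((h ^ 2) ^ e * (h * s ^ b)) = h * s ^ (a % 3) * h * s ^ b * (h ^ 2) ^ e := by
      rw [(hch.mul_right (hcs b)).eq, pow_eq_pow_mod a R.s_pow]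
      simp only [mul_assoc]
    rw [e1]
    have ha : a % 3 < 3 := Nat.mod_lt _ (by norm_num)
    generalize a % 3 = a at *
    -- In the big cell, `h sᵃ h` must be rewritten: for `a = 0` it is `h²` and falls into the small
    -- cell; for `a = 1, 2` the identities `h_s_h` and `h_s_inv_h` keep it in the big cell.
    interval_cases a
    · convert R.word_mem_range j (2 * i) b (e + 1) 1 (.inl rfl) using 1
      rw [mul_one, pow_zero, mul_one, mul_assoc (z ^ j * _), pow_succ' (h ^ 2), ← pow_two,
        (R.commute_sq_s.pow_right b).eq]
      simp only [mul_assoc]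
    · convert R.word_mem_range j (2 * i) 2 (e + 1) (h * s ^ (b + 2)) (.inr ⟨_, rfl⟩) using 1
      have : h * s ^ 1 * h * s ^ b * (h ^ 2) ^ e =
          s ^ 2 * ((h ^ 2) ^ (e + 1) * (h * s ^ (b + 2))) := by
        rw [pow_one, R.h_s_h, R.s_inv, ← pow_two]
        calc s ^ 2 * h * s ^ 2 * h ^ 2 * s ^ b * (h ^ 2) ^ e
            = s ^ 2 * h * s ^ 2 * (h ^ 2 * s ^ b) * (h ^ 2) ^ e := by simp only [mul_assoc]
          _ = s ^ 2 * ((h * s ^ (b + 2)) * (h ^ 2) ^ (e + 1)) := by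
            rw [(R.commute_sq_s.pow_right b).eq, add_comm b, pow_add s, pow_succ' (h ^ 2)]
            simp only [mul_assoc]
          _ = _ := by
            rw [((((Commute.refl h).pow_left 2).mul_right
              (R.commute_sq_s.pow_right (b + 2))).pow_left (e + 1)).eq]
      rw [this]
      simp only [mul_assoc]
    · convert R.word_mem_range j (2 * i) 1 e (h * s ^ (b + 1)) (.inr ⟨_, rfl⟩) using 1
      have : h * s ^ 2 * h * s ^ b * (h ^ 2) ^ e = s ^ 1 * ((h ^ 2) ^ e * (h * s ^ (b + 1))) := by
        rw [(hch.mul_right (hcs (b + 1))).eq, pow_two s, ← R.s_inv, R.h_s_inv_h, pow_succ' s b,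
          pow_one]
        simp only [mul_assoc]
      rw [this]
      simp only [mul_assoc]

theorem closure_subset_range {G : Type*} [Group G] {s z h : G} (R : CliffordRelations s z h) :
    (Submonoid.closure {s, z, h} : Set G) ⊆ Set.range (cliffordWord s z h) := by
  intro g hg
  induction hg using Submonoid.closure_induction_left with
  | one => exact ⟨(0, 0, 0, 0, none), by simp [cliffordWord]⟩
  | mul_left x hx y _ ih =>
    rcases hx with rfl | rfl | rfl
    · exact R.s_mul_mem ih
    · exact R.z_mul_mem ih
    · exact R.h_mul_mem ih

end CliffordRelations

/-! ### One-wire diagrams modulo rewriting -/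

/-- One-wire diagrams up to rewriting. -/
def oneWireSetoid : Setoid (Diagram 1 1) where
  r := Derivable
  iseqv := ⟨Derivable.refl, Derivable.symm, Derivable.trans⟩

/-- The classes of one-wire diagrams under rewriting. -/
def OneWire : Type := Quotient oneWireSetoid

namespace OneWire

/-- The class of a diagram. -/
def mk (D : Diagram 1 1) : OneWire := Quotient.mk oneWireSetoid D

theorem mk_eq_iff {D E : Diagram 1 1} : mk D = mk E ↔ Derivable D E := Quotient.eq (r := oneWireSetoid)

theorem derivable_tpow_one (D : Diagram 1 1) : Derivable (tpow D 1) D := Derivable.empty_tensor D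

/-- Products are in diagram order, top node on the left, opposite to the order of matrix products.
The unit laws pass through `ident 1`, which is the empty diagram beside a wire and not the wire
itself. -/
instance : Monoid OneWire where
  mul := Quotient.map₂ Diagram.comp fun _ _ h _ _ h' => Derivable.comp_congr h h'
  one := mk wire
  mul_assoc := by
    rintro ⟨D⟩ ⟨E⟩ ⟨F⟩
    exact mk_eq_iff.2 (Derivable.comp_assoc D E F)
  one_mul := by
    rintro ⟨D⟩
    exact mk_eq_iff.2 (((derivable_tpow_one wire).symm.comp_congr (.refl D)).trans
      (Derivable.id_comp D))
  mul_one := by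
    rintro ⟨D⟩
    exact mk_eq_iff.2 (((Derivable.refl D).comp_congr (derivable_tpow_one wire).symm).trans
      (Derivable.comp_id D))

theorem mk_comp (D E : Diagram 1 1) : mk (D ⨾ E) = mk D * mk E := rfl

theorem mk_green_mul (α β η θ : Real.Angle) :
    mk (spider .green 1 1 α β) * mk (spider .green 1 1 η θ) =
      mk (spider .green 1 1 (α + η) (β + θ)) := by
  rw [← mk_comp, mk_eq_iff]
  -- Fusion along a single wire with no bystanders; the empty sides are removed by the unit laws of
  -- the tensor product.
  refine .trans (.comp_congr ?_ ?_) (Derivable.S1 1 0 0 0 1 α β η θ)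
  · exact (Derivable.tensor_empty (spider .green 1 1 α β)).symm
  · exact (Derivable.empty_tensor (spider .green 1 1 η θ)).symm

theorem angle_add (a b : ZMod 3) : angle a + angle b = angle (a + b) := by
  rw [← Real.Angle.arg_toCircle (angle a + angle b), ← Real.Angle.arg_toCircle (angle (a + b))]
  congr 2
  rw [Real.Angle.toCircle_add, Circle.coe_mul, toCircle_angle, toCircle_angle, toCircle_angle,
    ωpow_add]

theorem mk_phase_green_mul (a b : ZMod 3 × ZMod 3) :
    mk (phase .green a) * mk (phase .green b) = mk (phase .green (a + b)) := by
  rw [phase, phase, mk_green_mul, angle_add, angle_add]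
  rfl

theorem mk_phase_green_zero : mk (phase .green 0) = 1 := by
  rw [phase, Prod.fst_zero, Prod.snd_zero, angle_zero]
  exact mk_eq_iff.2 .S2

/-- The class of the Hadamard node, as a unit. -/
def unitH : OneWireˣ :=
  ⟨mk had, mk hadDag, mk_eq_iff.2 .H1_left, mk_eq_iff.2 .H1_right⟩

/-- The class of a green node, as a unit. -/
noncomputable def unitGreen (a : ZMod 3 × ZMod 3) : OneWireˣ :=
  ⟨mk (phase .green a), mk (phase .green (-a)),
    by rw [mk_phase_green_mul, add_neg_cancel, mk_phase_green_zero],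
    by rw [mk_phase_green_mul, neg_add_cancel, mk_phase_green_zero]⟩

theorem unitGreen_mul (a b : ZMod 3 × ZMod 3) :
    unitGreen a * unitGreen b = unitGreen (a + b) := Units.ext (mk_phase_green_mul a b)

theorem unitGreen_pow (a : ZMod 3 × ZMod 3) (n : ℕ) : unitGreen a ^ n = unitGreen (n • a) := by
  induction n with
  | zero => rw [pow_zero, zero_smul]; exact Units.ext mk_phase_green_zero.symm
  | succ n ih => rw [pow_succ, ih, unitGreen_mul, succ_nsmul]

theorem mk_phase_red (a : ZMod 3 × ZMod 3) :
    mk (phase .red a) = ↑(unitH⁻¹ * unitGreen a * unitH) := by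
  have h := Derivable.H2 1 1 (angle a.1) (angle a.2)
  refine (mk_eq_iff.2 (h.symm.trans ?_))
  exact ((derivable_tpow_one _).comp_congr (.refl _)).comp_congr (derivable_tpow_one _)

theorem mk_phase_red_swap (a : ZMod 3 × ZMod 3) :
    mk (phase .red a.swap) = ↑(unitH * unitGreen a * unitH⁻¹) := by
  have h := Derivable.H2' 1 1 (angle a.1) (angle a.2)
  refine (mk_eq_iff.2 (h.symm.trans ?_))
  exact ((derivable_tpow_one _).comp_congr (.refl _)).comp_congr (derivable_tpow_one _)

/-- Red nodes are conjugates of green ones by H2, and in the other direction with swapped phases by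
H2'. The pair (2,2) is invariant under the swap and (1,2) is negated by it, which gives `conj_s` and
`conj_z`. K2 turns (2,2) into (1,0) = (2,2) + 2·(1,2) and fixes (1,2), which gives `shear` and
`weyl`. -/
theorem cliffordRelations : CliffordRelations (unitGreen (2, 2)) (unitGreen (1, 2)) unitH where
  s_pow := by
    rw [unitGreen_pow, ← pow_zero (unitGreen 0), unitGreen_pow]
    rfl
  z_pow := by
    rw [unitGreen_pow, ← pow_zero (unitGreen 0), unitGreen_pow]
    rfl
  comm := by rw [unitGreen_mul, unitGreen_mul, add_comm]
  euler := by
    apply Units.ext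
    rw [Units.val_mul, Units.val_mul, ← mk_phase_red]
    exact mk_eq_iff.2 .EU
  conj_s := by
    apply Units.ext
    rw [← mk_phase_red, ← mk_phase_red_swap]
    rfl
  conj_z := by
    have e : (unitGreen (1, 2))⁻¹ = unitGreen (2, 1) := by
      rw [inv_eq_iff_mul_eq_one, unitGreen_mul]
      exact Units.ext mk_phase_green_zero
    have e2 : (unitH⁻¹ * unitGreen (1, 2) * unitH)⁻¹ = unitH⁻¹ * unitGreen (2, 1) * unitH := by
      rw [← e]
      simp [mul_assoc]
    rw [e2]
    apply Units.ext
    rw [← mk_phase_red, ← mk_phase_red_swap]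
    rfl
  shear := by
    apply Units.ext
    rw [unitGreen_pow, unitGreen_mul, Units.val_mul (unitH⁻¹ * unitGreen (1, 2) * unitH),
      Units.val_mul _ (unitH⁻¹ * unitGreen (1, 2) * unitH), ← mk_phase_red]
    refine (mk_eq_iff.2 (Derivable.K2_12 (angle 2) (angle 2))).trans ?_
    rw [mk_comp]
    congr 1
    have h : -angle 2 = angle 1 := by
      rw [neg_eq_iff_add_eq_zero, angle_add, ← angle_zero]
      rfl
    rw [h, sub_self, ← angle_zero]
    rfl
  weyl := by
    apply Units.ext
    rw [Units.val_mul (unitH⁻¹ * unitGreen (1, 2) * unitH),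
      Units.val_mul _ (unitH⁻¹ * unitGreen (1, 2) * unitH), ← mk_phase_red]
    refine (mk_eq_iff.2 (Derivable.K2_12 (angle 1) (angle 2))).trans ?_
    rw [mk_comp]
    congr 1
    have h : -angle 2 = angle 1 := by
      rw [neg_eq_iff_add_eq_zero, angle_add, ← angle_zero]
      rfl
    rw [sub_eq_add_neg, h, angle_add]
    rfl

theorem exists_mk_eq_word {D : Diagram 1 1} (hD : IsCliffordDiagram D) :
    ∃ w, mk D = (cliffordWord (unitGreen (2, 2)) (unitGreen (1, 2)) unitH w : OneWireˣ) := by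
  have R := cliffordRelations
  suffices h : ∃ u ∈ Submonoid.closure {unitGreen (2, 2), unitGreen (1, 2), unitH}, mk D = u by
    obtain ⟨u, hu, e⟩ := h
    obtain ⟨w, rfl⟩ := R.closure_subset_range hu
    exact ⟨w, e⟩
  have hH : unitH ∈ Submonoid.closure {unitGreen (2, 2), unitGreen (1, 2), unitH} :=
    Submonoid.subset_closure (by simp)
  -- The closure is only a submonoid; the inverse comes from `h⁴ = 1`.
  have hH' : unitH⁻¹ ∈ Submonoid.closure {unitGreen (2, 2), unitGreen (1, 2), unitH} := by
    have e : unitH⁻¹ = unitH ^ 3 := by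
      refine inv_eq_of_mul_eq_one_right ?_
      rw [← pow_succ', ← R.h_pow_four, ← pow_mul]
    rw [e]
    exact pow_mem hH 3
  have hG : ∀ a, unitGreen a ∈ Submonoid.closure {unitGreen (2, 2), unitGreen (1, 2), unitH} := by
    intro a
    -- The two pairs form a basis of `ZMod 3 × ZMod 3`.
    have h : ∀ a : ZMod 3 × ZMod 3, ∃ m n : Fin 3, a = (m : ℕ) • (2, 2) + (n : ℕ) • (1, 2) := by
      decide
    obtain ⟨m, n, rfl⟩ := h a
    rw [← unitGreen_mul, ← unitGreen_pow, ← unitGreen_pow]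
    exact mul_mem (pow_mem (Submonoid.subset_closure (by simp)) _)
      (pow_mem (Submonoid.subset_closure (by simp)) _)
  induction hD with
  | wire => exact ⟨1, one_mem _, rfl⟩
  | phase c a =>
    cases c
    · exact ⟨_, hG a, rfl⟩
    · exact ⟨_, mul_mem (mul_mem hH' (hG a)) hH, mk_phase_red a⟩
  | had => exact ⟨_, hH, rfl⟩
  | hadDag => exact ⟨_, hH', rfl⟩
  | comp _ _ ih ih' =>
    obtain ⟨u, hu, e⟩ := ih
    obtain ⟨v, hv, e'⟩ := ih'
    exact ⟨u * v, mul_mem hu hv, by rw [mk_comp, e, e', Units.val_mul]⟩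

end OneWire

/-- A family of 216 Clifford diagrams with pairwise non-proportional interpretations contains every
Clifford diagram up to rewriting. -/
theorem exists_derivable_of_injective {ι : Type*} (hι : Nat.card ι = 216) (F : ι → Diagram 1 1)
    (hF : ∀ N, IsCliffordDiagram (F N))
    (hinj : ∀ N N', Proportional (interp (F N)) (interp (F N')) → N = N') {D : Diagram 1 1}
    (hD : IsCliffordDiagram D) : ∃ N, Derivable D (F N) := by
  choose w hw using fun N => OneWire.exists_mk_eq_word (hF N)
  have hfin : Finite ι := Nat.finite_of_card_ne_zero (by rw [hι]; norm_num)
  -- Equal words give derivable diagrams, hence proportional matrices by soundness.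
  have hwi : Function.Injective w := by
    intro N N' e
    refine hinj N N' (OneWire.mk_eq_iff.1 ?_).sound
    rw [hw N, hw N', e]
  have hws : Function.Surjective w := by
    refine ((Nat.bijective_iff_injective_and_card w).2 ⟨hwi, ?_⟩).2
    rw [hι]
    simp
  obtain ⟨v, hv⟩ := OneWire.exists_mk_eq_word hD
  obtain ⟨N, rfl⟩ := hws v
  exact ⟨N, OneWire.mk_eq_iff.1 (hv.trans (hw N).symm)⟩

/-! ### Conjugation of Pauli matrices -/

/-- The Pauli matrix `ω^δ X^v Z^w` on one qutrit. -/
noncomputable def pauli (p : ZMod 3 × ZMod 3 × ZMod 3) : QMatrix 1 1 :=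
  ωpow p.1 • XZ (fun _ => p.2.1) (fun _ => p.2.2)

theorem pauliGroup_one : pauliGroup 1 = Set.range pauli := by
  ext P
  constructor
  · rintro ⟨δ, v, w, rfl⟩
    refine ⟨(δ, v 0, w 0), ?_⟩
    rw [pauli]
    congr 2 <;> ext i <;> rw [Subsingleton.elim i 0]
  · rintro ⟨p, rfl⟩
    exact ⟨_, _, _, rfl⟩

theorem pauli_apply (p : ZMod 3 × ZMod 3 × ZMod 3) (y x : Fin 1 → ZMod 3) :
    pauli p y x = if y 0 = x 0 + p.2.1 then ωpow (p.1 + p.2.2 * x 0) else 0 := by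
  simp [pauli, XZ, funext_iff, ωpow_add]

theorem const_apply_zero (x : Fin 1 → ZMod 3) : (fun _ => x 0) = x :=
  funext fun i => congrArg x (Subsingleton.elim 0 i)

theorem mul_pauli_apply (U : QMatrix 1 1) (p : ZMod 3 × ZMod 3 × ZMod 3) (y x : Fin 1 → ZMod 3) :
    (U * pauli p) y x = U y (fun _ => x 0 + p.2.1) * ωpow (p.1 + p.2.2 * x 0) := by
  simp [Matrix.mul_apply, pauli_apply, sum_fin_one]

theorem pauli_mul_apply (U : QMatrix 1 1) (p : ZMod 3 × ZMod 3 × ZMod 3) (y x : Fin 1 → ZMod 3) :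
    (pauli p * U) y x =
      ωpow (p.1 + p.2.2 * (y 0 - p.2.1)) * U (fun _ => y 0 - p.2.1) x := by
  simp [Matrix.mul_apply, pauli_apply, sum_fin_one, ← sub_eq_iff_eq_add]

theorem pauli_injective : Function.Injective pauli := by
  rintro ⟨δ, v, w⟩ ⟨δ', v', w'⟩ h
  have hv : v = v' := by
    by_contra hv
    have := congrFun (congrFun h fun _ => v) fun _ => 0
    simp [pauli_apply, hv, ωpow_ne_zero] at this
  subst hv
  have h0 := congrFun (congrFun h fun _ => v) fun _ => 0
  have h1 := congrFun (congrFun h fun _ => 1 + v) fun _ => 1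
  simp only [pauli_apply, zero_add, if_true, mul_zero, add_zero, mul_one] at h0 h1
  have h0 := ωpow_injective h0
  subst h0
  rw [add_left_cancel (ωpow_injective h1)]

/-- The product of Pauli matrices in terms of their parameters. -/
def pauliMul (p q : ZMod 3 × ZMod 3 × ZMod 3) : ZMod 3 × ZMod 3 × ZMod 3 :=
  (p.1 + q.1 + p.2.2 * q.2.1, p.2.1 + q.2.1, p.2.2 + q.2.2)

theorem pauli_mul_pauli (p q : ZMod 3 × ZMod 3 × ZMod 3) :
    pauli p * pauli q = pauli (pauliMul p q) := by
  ext y x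
  rw [mul_pauli_apply, pauli_apply, pauli_apply, pauliMul, ite_mul, zero_mul, ← ωpow_add]
  congr 1
  · simp only [eq_iff_iff]
    constructor <;> rintro h <;> rw [h] <;> ring
  · congr 1
    ring

/-- `U` is a scalar multiple of a unitary matrix and conjugates Pauli matrices as `f`. -/
structure Conjugates (U : QMatrix 1 1) (f : ZMod 3 × ZMod 3 × ZMod 3 → ZMod 3 × ZMod 3 × ZMod 3) :
    Prop where
  unitary : ∃ (k : ℂ) (V : QMatrix 1 1), k ≠ 0 ∧ V ∈ Matrix.unitaryGroup (Fin 1 → ZMod 3) ℂ ∧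
    U = k • V
  mul_pauli : ∀ p, U * pauli p = pauli (f p) * U

namespace Conjugates

theorem smul {U : QMatrix 1 1} {f : ZMod 3 × ZMod 3 × ZMod 3 → ZMod 3 × ZMod 3 × ZMod 3}
    (h : Conjugates U f) {k : ℂ} (hk : k ≠ 0) : Conjugates (k • U) f where
  unitary := by
    obtain ⟨l, V, hl, hV, rfl⟩ := h.unitary
    exact ⟨k * l, V, mul_ne_zero hk hl, hV, smul_smul _ _ _⟩
  mul_pauli p := by rw [Matrix.smul_mul, h.mul_pauli, Matrix.mul_smul]

theorem of_proportional {U U' : QMatrix 1 1}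
    {f : ZMod 3 × ZMod 3 × ZMod 3 → ZMod 3 × ZMod 3 × ZMod 3}
    (h : Conjugates U f) (hU : Proportional U' U) : Conjugates U' f := by
  obtain ⟨k, hk, rfl⟩ := hU
  exact h.smul hk

theorem mul {U U' : QMatrix 1 1} {f g : ZMod 3 × ZMod 3 × ZMod 3 → ZMod 3 × ZMod 3 × ZMod 3}
    (h : Conjugates U f) (h' : Conjugates U' g) : Conjugates (U' * U) (g ∘ f) where
  unitary := by
    obtain ⟨l, V, hl, hV, rfl⟩ := h.unitary
    obtain ⟨l', V', hl', hV', rfl⟩ := h'.unitary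
    exact ⟨l' * l, V' * V, mul_ne_zero hl' hl, mul_mem hV' hV, by
      rw [Matrix.smul_mul, Matrix.mul_smul, smul_smul]⟩
  mul_pauli p := by
    rw [Matrix.mul_assoc, h.mul_pauli, ← Matrix.mul_assoc, h'.mul_pauli, Matrix.mul_assoc]
    rfl

theorem one : Conjugates 1 id where
  unitary := ⟨1, 1, one_ne_zero, one_mem _, (one_smul _ _).symm⟩
  mul_pauli p := by rw [Matrix.one_mul, Matrix.mul_one, id]

theorem exists_inverse {U : QMatrix 1 1}
    {f : ZMod 3 × ZMod 3 × ZMod 3 → ZMod 3 × ZMod 3 × ZMod 3} (h : Conjugates U f) :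
    ∃ V : QMatrix 1 1, V * U = 1 ∧ U * V = 1 := by
  obtain ⟨k, V, hk, hV, rfl⟩ := h.unitary
  refine ⟨k⁻¹ • star V, ?_, ?_⟩
  · rw [Matrix.smul_mul, Matrix.mul_smul, smul_smul, inv_mul_cancel₀ hk, one_smul]
    exact Matrix.mem_unitaryGroup_iff'.1 hV
  · rw [Matrix.smul_mul, Matrix.mul_smul, smul_smul, mul_inv_cancel₀ hk, one_smul]
    exact Matrix.mem_unitaryGroup_iff.1 hV

theorem unique {U : QMatrix 1 1} {f g : ZMod 3 × ZMod 3 × ZMod 3 → ZMod 3 × ZMod 3 × ZMod 3}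
    (h : Conjugates U f) (h' : Conjugates U g) : f = g := by
  obtain ⟨V, -, hV⟩ := h.exists_inverse
  ext1 p
  apply pauli_injective
  have e := (h.mul_pauli p).symm.trans (h'.mul_pauli p)
  have e' := congrArg (· * V) e
  simpa only [Matrix.mul_assoc, hV, Matrix.mul_one] using e'

theorem injective {U : QMatrix 1 1} {f : ZMod 3 × ZMod 3 × ZMod 3 → ZMod 3 × ZMod 3 × ZMod 3}
    (h : Conjugates U f) : Function.Injective f := by
  obtain ⟨V, hV, -⟩ := h.exists_inverse
  intro p q e
  apply pauli_injective
  have e := (h.mul_pauli p).trans ((congrArg (pauli · * U) e).trans (h.mul_pauli q).symm)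
  have e' := congrArg (V * ·) e
  simpa only [← Matrix.mul_assoc, hV, Matrix.one_mul] using e'

theorem map_pauliMul {U : QMatrix 1 1}
    {f : ZMod 3 × ZMod 3 × ZMod 3 → ZMod 3 × ZMod 3 × ZMod 3}
    (h : Conjugates U f) (p q : ZMod 3 × ZMod 3 × ZMod 3) :
    f (pauliMul p q) = pauliMul (f p) (f q) := by
  obtain ⟨V, -, hV⟩ := h.exists_inverse
  apply pauli_injective
  have e : pauli (f (pauliMul p q)) * U = pauli (pauliMul (f p) (f q)) * U := by
    rw [← h.mul_pauli, ← pauli_mul_pauli, ← pauli_mul_pauli, Matrix.mul_assoc, ← h.mul_pauli,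
      ← Matrix.mul_assoc, ← Matrix.mul_assoc, h.mul_pauli]
  have e' := congrArg (· * V) e
  simpa only [Matrix.mul_assoc, hV, Matrix.mul_one] using e'

theorem map_scalar {U : QMatrix 1 1}
    {f : ZMod 3 × ZMod 3 × ZMod 3 → ZMod 3 × ZMod 3 × ZMod 3}
    (h : Conjugates U f) (δ : ZMod 3) : f (δ, 0, 0) = (δ, 0, 0) := by
  obtain ⟨V, -, hV⟩ := h.exists_inverse
  apply pauli_injective
  have e0 : pauli (δ, 0, 0) = ωpow δ • 1 := by
    ext y x
    rw [pauli_apply, Matrix.smul_apply, Matrix.one_apply]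
    simp [funext_iff]
  have e : pauli (f (δ, 0, 0)) * U = pauli (δ, 0, 0) * U := by
    rw [← h.mul_pauli, e0, Matrix.mul_smul, Matrix.smul_mul, Matrix.mul_one, Matrix.one_mul]
  have e' := congrArg (· * V) e
  simpa only [Matrix.mul_assoc, hV, Matrix.mul_one] using e'

/-- Conjugation is multiplicative and fixes scalars, so the images of `Z` and `X` inherit `ZX =
ωXZ`. -/
theorem symplectic {U : QMatrix 1 1}
    {f : ZMod 3 × ZMod 3 × ZMod 3 → ZMod 3 × ZMod 3 × ZMod 3} (h : Conjugates U f) :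
    pauliMul (f (0, 0, 1)) (f (0, 1, 0)) =
      pauliMul (1, 0, 0) (pauliMul (f (0, 1, 0)) (f (0, 0, 1))) := by
  rw [← h.map_scalar, ← h.map_pauliMul, ← h.map_pauliMul, ← h.map_pauliMul]
  congr 1

theorem mem_cliffordGroup {V : QMatrix 1 1}
    {f : ZMod 3 × ZMod 3 × ZMod 3 → ZMod 3 × ZMod 3 × ZMod 3} (h : Conjugates V f)
    (hV : V ∈ Matrix.unitaryGroup (Fin 1 → ZMod 3) ℂ) : V ∈ cliffordGroup 1 := by
  refine ⟨hV, ?_⟩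
  have e : ∀ p, V * pauli p * Vᴴ = pauli (f p) := by
    intro p
    rw [h.mul_pauli, Matrix.mul_assoc]
    exact (congrArg (pauli (f p) * ·) (Matrix.mem_unitaryGroup_iff.1 hV)).trans (Matrix.mul_one _)
  rw [pauliGroup_one]
  ext P
  constructor
  · rintro ⟨_, ⟨p, rfl⟩, rfl⟩
    exact ⟨f p, (e p).symm⟩
  · rintro ⟨p, rfl⟩
    obtain ⟨q, rfl⟩ := Finite.surjective_of_injective h.injective p
    exact ⟨_, ⟨q, rfl⟩, e q⟩

theorem of_mem_cliffordGroup {U : QMatrix 1 1} (hU : U ∈ cliffordGroup 1) :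
    ∃ f, Conjugates U f := by
  obtain ⟨hU, h⟩ := hU
  rw [pauliGroup_one] at h
  have h' : ∀ p, ∃ q, pauli q = U * pauli p * Uᴴ := fun p =>
    h.subset ⟨_, ⟨p, rfl⟩, rfl⟩
  choose f hf using h'
  refine ⟨f, ⟨1, U, one_ne_zero, hU, (one_smul _ _).symm⟩, fun p => ?_⟩
  rw [hf, Matrix.mul_assoc]
  exact ((congrArg (U * pauli p * ·) (Matrix.mem_unitaryGroup_iff'.1 hU)).trans
    (Matrix.mul_one _)).symm

/-- Commuting with `Z`, whose eigenvalues are distinct, makes `W` diagonal; commuting with `X` makes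
the diagonal constant. -/
theorem scalar_of_commute {W : QMatrix 1 1} (hX : W * pauli (0, 1, 0) = pauli (0, 1, 0) * W)
    (hZ : W * pauli (0, 0, 1) = pauli (0, 0, 1) * W) : W = W (fun _ => 0) (fun _ => 0) • 1 := by
  have hZ' : ∀ k l : ZMod 3, k ≠ l → W (fun _ => k) (fun _ => l) = 0 := by
    intro k l hkl
    have e := congrFun (congrFun hZ fun _ => k) fun _ => l
    simp only [mul_pauli_apply, pauli_mul_apply, zero_add, one_mul, add_zero, sub_zero] at e
    by_contra h0
    refine hkl (ωpow_injective (mul_right_cancel₀ h0 ?_))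
    rw [← e, mul_comm]
  have hX' : ∀ k : ZMod 3, W (fun _ => k + 1) (fun _ => k + 1) = W (fun _ => k) (fun _ => k) := by
    intro k
    have e := congrFun (congrFun hX fun _ => k + 1) fun _ => k
    simpa [mul_pauli_apply, pauli_mul_apply] using e
  have h0 : ∀ k : ZMod 3, W (fun _ => k) (fun _ => k) = W (fun _ => 0) (fun _ => 0) := by
    intro k
    rcases zmod_three_cases k with rfl | rfl | rfl
    · rfl
    · simpa using hX' 0
    · exact (hX' 1).trans (by simpa using hX' 0)
  ext y x
  rw [← const_apply_zero y, ← const_apply_zero x, Matrix.smul_apply, Matrix.one_apply]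
  by_cases hyx : y 0 = x 0
  · rw [hyx, h0]
    simp
  · rw [hZ' _ _ hyx, if_neg]
    · simp
    · exact fun h => hyx (congrFun h 0)

/-- Schur's argument: `V⁻¹U` commutes with `X` and `Z`, hence is scalar, and the scalar is non-zero
because `U` is invertible. -/
theorem proportional {U V : QMatrix 1 1}
    {f g : ZMod 3 × ZMod 3 × ZMod 3 → ZMod 3 × ZMod 3 × ZMod 3} (hU : Conjugates U f)
    (hV : Conjugates V g) (hX : f (0, 1, 0) = g (0, 1, 0)) (hZ : f (0, 0, 1) = g (0, 0, 1)) :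
    Proportional U V := by
  obtain ⟨V', hl, hr⟩ := hV.exists_inverse
  obtain ⟨U', -, hr'⟩ := hU.exists_inverse
  have key : ∀ p, f p = g p → V' * U * pauli p = pauli p * (V' * U) := by
    intro p hp
    calc V' * U * pauli p = V' * (pauli (g p) * (V * V')) * U := by
          rw [Matrix.mul_assoc, hU.mul_pauli, hr, hp]
          simp only [Matrix.mul_assoc, Matrix.one_mul]
      _ = V' * (V * pauli p * V') * U := by rw [hV.mul_pauli]; simp only [Matrix.mul_assoc]
      _ = V' * V * pauli p * (V' * U) := by simp only [Matrix.mul_assoc]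
      _ = pauli p * (V' * U) := by rw [hl, Matrix.one_mul]
  have e := scalar_of_commute (key _ hX) (key _ hZ)
  have e' : U = (V' * U) (fun _ => 0) (fun _ => 0) • V := by
    calc U = V * (V' * U) := by rw [← Matrix.mul_assoc, hr, Matrix.one_mul]
      _ = (V' * U) (fun _ => 0) (fun _ => 0) • V := by rw [e, Matrix.mul_smul, Matrix.mul_one]; simp
  refine ⟨_, fun h0 => ?_, e'⟩
  rw [h0, zero_smul] at e'
  rw [e', Matrix.zero_mul] at hr'
  exact zero_ne_one hr'

theorem of_mul_conjTranspose {U : QMatrix 1 1}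
    {f : ZMod 3 × ZMod 3 × ZMod 3 → ZMod 3 × ZMod 3 × ZMod 3} (r : ℝ) (hr : 0 < r)
    (hU : U * Uᴴ = (r : ℂ) • 1) (h : ∀ p, U * pauli p = pauli (f p) * U) : Conjugates U f where
  unitary := by
    have h0 : ((√r : ℝ) : ℂ) ≠ 0 := by simpa using (Real.sqrt_pos.2 hr).ne'
    refine ⟨(√r : ℝ), ((√r : ℝ) : ℂ)⁻¹ • U, h0, ?_, ?_⟩
    · rw [Matrix.mem_unitaryGroup_iff, Matrix.star_eq_conjTranspose, Matrix.conjTranspose_smul,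
        Matrix.smul_mul, Matrix.mul_smul, hU, smul_smul, smul_smul]
      have : ((√r : ℝ) : ℂ) * (√r : ℝ) = r := by exact_mod_cast Real.mul_self_sqrt hr.le
      rw [← this]
      have hs : star ((√r : ℝ) : ℂ)⁻¹ = ((√r : ℝ) : ℂ)⁻¹ := by
        rw [star_inv₀, Complex.star_def, Complex.conj_ofReal]
      rw [hs, mul_mul_mul_comm, inv_mul_cancel₀ h0, one_mul, one_smul]
    · rw [smul_smul, mul_inv_cancel₀ h0, one_smul]
  mul_pauli := h

end Conjugates

/-! ### The action of the nodes on Pauli matrices -/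

/-- The conjugation by the green node with phases `a`. -/
def conjGreen (a : ZMod 3 × ZMod 3) (p : ZMod 3 × ZMod 3 × ZMod 3) : ZMod 3 × ZMod 3 × ZMod 3 :=
  (p.1 - (a.1 + a.2) * p.2.1 ^ 2 + (a.2 - a.1) * p.2.1, p.2.1, p.2.2 + (a.1 + a.2) * p.2.1)

/-- The conjugation by the Hadamard node. -/
def conjHad (p : ZMod 3 × ZMod 3 × ZMod 3) : ZMod 3 × ZMod 3 × ZMod 3 :=
  (p.1 - p.2.1 * p.2.2, -p.2.2, p.2.1)

/-- The conjugation by the inverse of the Hadamard node. -/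
def conjHadDag (p : ZMod 3 × ZMod 3 × ZMod 3) : ZMod 3 × ZMod 3 × ZMod 3 :=
  (p.1 - p.2.1 * p.2.2, p.2.2, -p.2.1)

/-- The conjugation by a node with phases `a`. -/
def conjPhase : Colour → ZMod 3 × ZMod 3 → ZMod 3 × ZMod 3 × ZMod 3 → ZMod 3 × ZMod 3 × ZMod 3
  | .green, a => conjGreen a
  | .red, a => conjHad ∘ conjGreen a ∘ conjHadDag

theorem conjugates_green (a : ZMod 3 × ZMod 3) :
    Conjugates (interp (phase .green a)) (conjGreen a) := by
  refine .of_mul_conjTranspose 1 one_pos ?_ fun p => ?_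
  · ext y x
    rw [Matrix.mul_apply, sum_fin_one]
    simp only [Matrix.conjTranspose_apply, interp_eq_entry, phase, entry_green, phaseCoeff_angle,
      apply_ite star, star_ωpow, star_zero, ite_mul, zero_mul, Finset.sum_ite_eq, Finset.mem_univ,
      if_true, mul_ite, mul_zero, ← ωpow_add]
    simp [Matrix.one_apply, funext_iff]
  · ext y x
    rw [mul_pauli_apply, pauli_mul_apply]
    simp only [interp_eq_entry, phase, entry_green, phaseCoeff_angle, conjGreen, sub_eq_iff_eq_add,
      ite_mul, mul_ite, zero_mul, mul_zero, ← ωpow_add]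
    split_ifs with h
    · have h3 : (3 : ZMod 3) = 0 := rfl
      congr 1
      rw [h]
      linear_combination -(a.1 + a.2) * x 0 * p.2.1 * h3
    · rfl

theorem conjugates_had : Conjugates (interp had) conjHad := by
  refine .of_mul_conjTranspose 3 three_pos ?_ fun p => ?_
  · ext y x
    rw [Matrix.mul_apply, sum_fin_one]
    have h : ∀ l : ZMod 3, l * y 0 + -(l * x 0) = l * (y 0 - x 0) := fun l => by ring
    simp only [Matrix.conjTranspose_apply, interp_eq_entry, entry_had, star_ωpow, ← ωpow_add, h,
      sum_ωpow_mul, sub_eq_zero]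
    simp [Matrix.one_apply, funext_iff]
  · ext y x
    rw [mul_pauli_apply, pauli_mul_apply]
    simp only [interp_eq_entry, entry_had, conjHad, ← ωpow_add]
    congr 1
    ring

theorem conjugates_hadDag : Conjugates (interp hadDag) conjHadDag := by
  refine .of_mul_conjTranspose 3 three_pos ?_ fun p => ?_
  · ext y x
    rw [Matrix.mul_apply, sum_fin_one]
    have h : ∀ l : ZMod 3, -(l * y 0) + (l * x 0) = l * (x 0 - y 0) := fun l => by ring
    simp only [Matrix.conjTranspose_apply, interp_eq_entry, entry_hadDag, star_ωpow, neg_neg,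
      ← ωpow_add, h, sum_ωpow_mul, sub_eq_zero]
    simp [Matrix.one_apply, funext_iff, @eq_comm _ (x 0)]
  · ext y x
    rw [mul_pauli_apply, pauli_mul_apply]
    simp only [interp_eq_entry, entry_hadDag, conjHadDag, ← ωpow_add]
    congr 1
    ring

theorem conjugates_phase (c : Colour) (a : ZMod 3 × ZMod 3) :
    Conjugates (interp (phase c a)) (conjPhase c a) := by
  cases c
  · exact conjugates_green a
  · have e : interp (phase .red a) = interp had * (interp (phase .green a) * interp hadDag) := by
      have h := interp_H2 1 1 (angle a.1) (angle a.2)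
      rw [interp_comp, interp_comp, interp_tpow_one, interp_tpow_one] at h
      exact h.symm
    rw [e]
    exact (conjugates_hadDag.mul (conjugates_green a)).mul conjugates_had

theorem exists_conjugates {D : Diagram 1 1} (hD : IsCliffordDiagram D) :
    ∃ f, Conjugates (interp D) f := by
  induction hD with
  | wire => exact ⟨id, interp_wire ▸ .one⟩
  | phase c a => exact ⟨_, conjugates_phase c a⟩
  | had => exact ⟨_, conjugates_had⟩
  | hadDag => exact ⟨_, conjugates_hadDag⟩
  | comp _ _ ih ih' =>
    obtain ⟨f, hf⟩ := ih
    obtain ⟨g, hg⟩ := ih'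
    exact ⟨_, interp_comp _ _ ▸ hf.mul hg⟩

theorem exists_proportional_mem_cliffordGroup {D : Diagram 1 1} (hD : IsCliffordDiagram D) :
    ∃ U ∈ cliffordGroup 1, Proportional (interp D) U := by
  obtain ⟨f, hf⟩ := exists_conjugates hD
  obtain ⟨k, V, hk, hV, e⟩ := hf.unitary
  have hp : Proportional (interp D) V := ⟨k, hk, e⟩
  exact ⟨V, (hf.of_proportional hp.symm).mem_cliffordGroup hV, hp⟩

/-! ### Normal forms -/

/-- The normal forms as a sum of products. -/
def NormalForm.equivSum :
    NormalForm ≃ (setA × setA) ⊕ (setA × setP × setQ) ⊕ (setA × setM) where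
  toFun
    | .form1 a b => .inl (a, b)
    | .form2 a p q => .inr (.inl (a, p, q))
    | .form3 a m => .inr (.inr (a, m))
  invFun
    | .inl (a, b) => .form1 a b
    | .inr (.inl (a, p, q)) => .form2 a p q
    | .inr (.inr (a, m)) => .form3 a m
  left_inv := by rintro (_ | _ | _) <;> rfl
  right_inv := by rintro (_ | _ | _) <;> rfl

theorem card_normalForm : Nat.card NormalForm = 216 := by
  rw [Nat.card_congr NormalForm.equivSum, Nat.card_eq_fintype_card]
  simp only [Fintype.card_sum, Fintype.card_prod, Fintype.card_coe]
  decide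

/-- The outer node with phases in `𝓐`. -/
def NormalForm.head : NormalForm → setA
  | .form1 a _ => a
  | .form2 a _ _ => a
  | .form3 a _ => a

/-- The parameters of the other nodes. -/
def NormalForm.tail : NormalForm → setA ⊕ (setP × setQ) ⊕ setM
  | .form1 _ b => .inl b
  | .form2 _ p q => .inr (.inl (p, q))
  | .form3 _ m => .inr (.inr m)

theorem NormalForm.ext_head_tail {N N' : NormalForm} (h : N.head = N'.head)
    (h' : N.tail = N'.tail) : N = N' := by
  cases N <;> cases N' <;> simp_all [NormalForm.head, NormalForm.tail]

/-- The conjugation of Pauli matrices by the nodes below the outer one. -/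
def tailConj (c : Colour) :
    setA ⊕ (setP × setQ) ⊕ setM → ZMod 3 × ZMod 3 × ZMod 3 → ZMod 3 × ZMod 3 × ZMod 3
  | .inl b => conjPhase c.flip b
  | .inr (.inl (p, q)) => conjPhase c q ∘ conjPhase c.flip p
  | .inr (.inr m) => conjPhase c.flip m ∘ conjHad ∘ conjHad

/-- The conjugation of Pauli matrices by the nodes above the outer one of a reversed normal form. -/
def tailConjMirror (c : Colour) :
    setA ⊕ (setP × setQ) ⊕ setM → ZMod 3 × ZMod 3 × ZMod 3 → ZMod 3 × ZMod 3 × ZMod 3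
  | .inl b => conjPhase c.flip b
  | .inr (.inl (p, q)) => conjPhase c.flip p ∘ conjPhase c q
  | .inr (.inr m) => conjHad ∘ conjHad ∘ conjPhase c.flip m

theorem conjugates_diagram (c : Colour) (N : NormalForm) :
    Conjugates (interp (N.diagram c)) (tailConj c N.tail ∘ conjPhase c N.head) := by
  cases N <;> simp only [NormalForm.diagram, interp_comp]
  · exact (conjugates_phase _ _).mul (conjugates_phase _ _)
  · exact ((conjugates_phase _ _).mul (conjugates_phase _ _)).mul (conjugates_phase _ _)
  · exact (((conjugates_phase _ _).mul conjugates_had).mul conjugates_had).mul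
      (conjugates_phase _ _)

theorem conjugates_mirror (c : Colour) (N : NormalForm) :
    Conjugates (interp (N.mirror c)) (conjPhase c N.head ∘ tailConjMirror c N.tail) := by
  cases N <;> simp only [NormalForm.mirror, interp_comp]
  · exact (conjugates_phase _ _).mul (conjugates_phase _ _)
  · exact ((conjugates_phase _ _).mul (conjugates_phase _ _)).mul (conjugates_phase _ _)
  · exact (((conjugates_phase _ _).mul conjugates_had).mul conjugates_had).mul
      (conjugates_phase _ _)

theorem isCliffordDiagram_diagram (c : Colour) (N : NormalForm) :
    IsCliffordDiagram (N.diagram c) := by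
  cases N
  · exact (IsCliffordDiagram.phase _ _).comp (.phase _ _)
  · exact ((IsCliffordDiagram.phase _ _).comp (.phase _ _)).comp (.phase _ _)
  · exact (((IsCliffordDiagram.phase _ _).comp .had).comp .had).comp (.phase _ _)

theorem isCliffordDiagram_mirror (c : Colour) (N : NormalForm) :
    IsCliffordDiagram (N.mirror c) := by
  cases N
  · exact (IsCliffordDiagram.phase _ _).comp (.phase _ _)
  · exact ((IsCliffordDiagram.phase _ _).comp (.phase _ _)).comp (.phase _ _)
  · exact (((IsCliffordDiagram.phase _ _).comp .had).comp .had).comp (.phase _ _)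

/-! ### Separating the normal forms by their action on Pauli matrices -/

theorem conjPhase_injective (c : Colour) (a : ZMod 3 × ZMod 3) :
    Function.Injective (conjPhase c a) := (conjugates_phase c a).injective

theorem tailConj_injective (c : Colour) (t : setA ⊕ (setP × setQ) ⊕ setM) :
    Function.Injective (tailConj c t) := by
  rcases t with b | ⟨p, q⟩ | m
  · exact conjPhase_injective _ _
  · exact (conjPhase_injective _ _).comp (conjPhase_injective _ _)
  · exact (conjPhase_injective _ _).comp (conjugates_had.injective.comp conjugates_had.injective)

theorem tailConjMirror_injective (c : Colour) (t : setA ⊕ (setP × setQ) ⊕ setM) :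
    Function.Injective (tailConjMirror c t) := by
  rcases t with b | ⟨p, q⟩ | m
  · exact conjPhase_injective _ _
  · exact (conjPhase_injective _ _).comp (conjPhase_injective _ _)
  · exact (conjugates_had.injective.comp conjugates_had.injective).comp (conjPhase_injective _ _)

/-- The Pauli matrix `Z` or `X` that commutes with the nodes of a colour. -/
def axis : Colour → ZMod 3 × ZMod 3 × ZMod 3
  | .green => (0, 0, 1)
  | .red => (0, 1, 0)

theorem conjPhase_axis (c : Colour) (a : ZMod 3 × ZMod 3) :
    conjPhase c a (axis c) = axis c := by
  cases c <;> revert a <;> decide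

/-- For green, the image of `X` has parameters `(a₁, 1, a₁ + a₂)`, from which both phases can be
read off. -/
theorem conjPhase_axis_flip (c : Colour) {a b : ZMod 3 × ZMod 3}
    (h : conjPhase c a (axis c.flip) = conjPhase c b (axis c.flip)) : a = b := by
  cases c <;> revert a b <;> decide +kernel

/-- There are 9 + 2·6 + 3 = 24 tails, as many as non-scalar Pauli matrices, and each sends the axis
to a different one. -/
theorem tailConj_axis (c : Colour) : ∀ t t', tailConj c t (axis c) = tailConj c t' (axis c) →
    t = t' := by
  cases c <;> decide +kernel

/-- The preimage of the axis under `tailConjMirror`. -/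
def mirrorAxis (c : Colour) : setA ⊕ (setP × setQ) ⊕ setM → ZMod 3 × ZMod 3 × ZMod 3
  | .inl b => conjPhase c.flip (-b) (axis c)
  | .inr (.inl (p, q)) => conjPhase c (-q) (conjPhase c.flip (-p) (axis c))
  | .inr (.inr m) => conjPhase c.flip (-m) (conjHad (conjHad (axis c)))

theorem tailConjMirror_mirrorAxis (c : Colour) : ∀ t,
    tailConjMirror c t (mirrorAxis c t) = axis c := by
  cases c <;> decide +kernel

theorem mirrorAxis_injective (c : Colour) : ∀ t t', mirrorAxis c t = mirrorAxis c t' → t = t' := by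
  cases c <;> decide +kernel

/-- The head fixes the axis of its colour, so the image of that axis reveals the tail. After
cancelling the tail, the image of the other axis reveals the head. -/
theorem diagram_injective (c : Colour) (N N' : NormalForm)
    (h : Proportional (interp (N.diagram c)) (interp (N'.diagram c))) : N = N' := by
  have e := (conjugates_diagram c N).unique ((conjugates_diagram c N').of_proportional h)
  have ht : N.tail = N'.tail := by
    have := congrFun e (axis c)
    simp only [Function.comp_apply, conjPhase_axis] at this
    exact tailConj_axis c _ _ this
  refine NormalForm.ext_head_tail (Subtype.ext (conjPhase_axis_flip c ?_)) ht
  apply tailConj_injective c N.tail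
  have := congrFun e (axis c.flip)
  rwa [← ht] at this

/-- Here the tail acts first, so it is read off from the preimage of the axis, which the head does
not change. -/
theorem mirror_injective (c : Colour) (N N' : NormalForm)
    (h : Proportional (interp (N.mirror c)) (interp (N'.mirror c))) : N = N' := by
  have e := (conjugates_mirror c N).unique ((conjugates_mirror c N').of_proportional h)
  have ht : N.tail = N'.tail := by
    have := congrFun e (mirrorAxis c N.tail)
    simp only [Function.comp_apply, tailConjMirror_mirrorAxis] at this
    rw [conjPhase_axis, ← conjPhase_axis c N'.head] at this
    apply mirrorAxis_injective c
    apply tailConjMirror_injective c N'.tail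
    rw [tailConjMirror_mirrorAxis]
    exact (conjPhase_injective _ _ this).symm
  refine NormalForm.ext_head_tail (Subtype.ext (conjPhase_axis_flip c ?_)) ht
  -- Pulling the other axis back through the common tail feeds it to the two heads.
  obtain ⟨p, hp⟩ := Finite.surjective_of_injective (tailConjMirror_injective c N.tail) (axis c.flip)
  rw [← hp]
  have := congrFun e p
  rwa [← ht] at this

/-! ### Counting Clifford operators modulo scalars -/

/-- The possible images of `X` and `Z` under conjugation. -/
def symplecticPairs : Finset ((ZMod 3 × ZMod 3 × ZMod 3) × (ZMod 3 × ZMod 3 × ZMod 3)) :=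
  Finset.univ.filter fun p => pauliMul p.2 p.1 = pauliMul (1, 0, 0) (pauliMul p.1 p.2)

/-- The image of `X` is one of 24 non-scalar Pauli matrices; the commutation relation then leaves 3
exponent vectors and 3 phases for the image of `Z`. -/
theorem card_symplecticPairs : symplecticPairs.card = 216 := by
  decide +kernel

theorem Conjugates.mem_symplecticPairs {U : QMatrix 1 1}
    {f : ZMod 3 × ZMod 3 × ZMod 3 → ZMod 3 × ZMod 3 × ZMod 3} (h : Conjugates U f) :
    (f (0, 1, 0), f (0, 0, 1)) ∈ symplecticPairs :=
  Finset.mem_filter.2 ⟨Finset.mem_univ _, h.symplectic⟩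

/-- A family of 216 Clifford diagrams with pairwise non-proportional interpretations represents
every element of the Clifford group. -/
theorem exists_proportional_of_injective {ι : Type*} (hι : Nat.card ι = 216)
    (F : ι → Diagram 1 1) (hF : ∀ N, IsCliffordDiagram (F N))
    (hinj : ∀ N N', Proportional (interp (F N)) (interp (F N')) → N = N') {U : QMatrix 1 1}
    (hU : U ∈ cliffordGroup 1) : ∃ N, Proportional (interp (F N)) U := by
  choose f hf using fun N => exists_conjugates (hF N)
  have hfin : Finite ι := Nat.finite_of_card_ne_zero (by rw [hι]; norm_num)
  let w : ι → symplecticPairs := fun N => ⟨_, (hf N).mem_symplecticPairs⟩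
  have hwi : Function.Injective w := by
    intro N N' e
    have e' := Prod.ext_iff.1 (Subtype.ext_iff.1 e)
    exact hinj N N' ((hf N).proportional (hf N') e'.1 e'.2)
  have hws : Function.Surjective w := by
    refine ((Nat.bijective_iff_injective_and_card w).2 ⟨hwi, ?_⟩).2
    rw [hι, Nat.card_eq_fintype_card, Fintype.card_coe, card_symplecticPairs]
  obtain ⟨g, hg⟩ := Conjugates.of_mem_cliffordGroup hU
  obtain ⟨N, hN⟩ := hws ⟨_, hg.mem_symplecticPairs⟩
  have e' := Prod.ext_iff.1 (Subtype.ext_iff.1 hN)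
  exact ⟨N, (hf N).proportional hg e'.1 e'.2⟩

end QutritZX

/-! ### The main theorem -/

theorem mainTheorem3 :
    (∀ (c : QutritZX.Colour) (F : QutritZX.NormalForm → QutritZX.Diagram 1 1),
      F = QutritZX.NormalForm.diagram c ∨ F = QutritZX.NormalForm.mirror c →
        (∀ N : QutritZX.NormalForm, QutritZX.IsCliffordDiagram (F N)) ∧
        (∀ D : QutritZX.Diagram 1 1, QutritZX.IsCliffordDiagram D →
          ∃! N : QutritZX.NormalForm, QutritZX.Derivable D (F N)) ∧
        (∀ U ∈ QutritZX.cliffordGroup 1,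
          ∃! N : QutritZX.NormalForm, QutritZX.Proportional (QutritZX.interp (F N)) U)) ∧
    Nat.card QutritZX.NormalForm = 216 ∧
    (∀ D : QutritZX.Diagram 1 1, QutritZX.IsCliffordDiagram D →
      ∃ U ∈ QutritZX.cliffordGroup 1, QutritZX.Proportional (QutritZX.interp D) U) ∧
    (∀ D D' : QutritZX.Diagram 1 1,
      QutritZX.IsCliffordDiagram D → QutritZX.IsCliffordDiagram D' →
        (QutritZX.Derivable D D' ↔
          QutritZX.Proportional (QutritZX.interp D) (QutritZX.interp D'))) := by
  have hinj : ∀ (c : QutritZX.Colour) (F : QutritZX.NormalForm → QutritZX.Diagram 1 1),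
      F = QutritZX.NormalForm.diagram c ∨ F = QutritZX.NormalForm.mirror c → ∀ N N',
        QutritZX.Proportional (QutritZX.interp (F N)) (QutritZX.interp (F N')) → N = N' := by
    rintro c F (rfl | rfl)
    · exact QutritZX.diagram_injective c
    · exact QutritZX.mirror_injective c
  have hcl : ∀ (c : QutritZX.Colour) (F : QutritZX.NormalForm → QutritZX.Diagram 1 1),
      F = QutritZX.NormalForm.diagram c ∨ F = QutritZX.NormalForm.mirror c → ∀ N,
        QutritZX.IsCliffordDiagram (F N) := by
    rintro c F (rfl | rfl)
    · exact QutritZX.isCliffordDiagram_diagram c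
    · exact QutritZX.isCliffordDiagram_mirror c
  refine ⟨fun c F hF => ⟨hcl c F hF, fun D hD => ?_, fun U hU => ?_⟩, QutritZX.card_normalForm,
    fun D => QutritZX.exists_proportional_mem_cliffordGroup, fun D D' hD hD' => ⟨fun h => h.sound,
    fun h => ?_⟩⟩
  · obtain ⟨N, hN⟩ := QutritZX.exists_derivable_of_injective QutritZX.card_normalForm F
      (hcl c F hF) (hinj c F hF) hD
    exact ⟨N, hN, fun N' hN' => hinj c F hF _ _ (hN'.symm.trans hN).sound⟩
  · obtain ⟨N, hN⟩ := QutritZX.exists_proportional_of_injective QutritZX.card_normalForm F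
      (hcl c F hF) (hinj c F hF) hU
    exact ⟨N, hN, fun N' hN' => hinj c F hF _ _ (hN'.trans hN.symm)⟩
  -- Any of the four families would serve; both diagrams rewrite to green-headed normal forms, which
  -- coincide because their matrices are proportional.
  · have hdiag := QutritZX.diagram_injective .green
    have hcliff := QutritZX.isCliffordDiagram_diagram .green
    obtain ⟨N, hN⟩ := QutritZX.exists_derivable_of_injective QutritZX.card_normalForm _
      hcliff hdiag hD
    obtain ⟨N', hN'⟩ := QutritZX.exists_derivable_of_injective QutritZX.card_normalForm _
      hcliff hdiag hD'
    obtain rfl := hdiag N N' (hN.sound.symm.trans (h.trans hN'.sound))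
    exact hN.trans hN'.symm
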